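/- Let $N_1,N_2$ be independent standard Gaussian random variables and let $\mu_\infty$ be the law of $N_1N_2$ on $\mathbb{R}$. Consider the differential operator $$(\mathfrak{R} f)(x) = x f(x) - f'(x) - x f''(x)$$ as an operator in $L^2(\mathbb{R},\mu_\infty)$, with domain the set of all $f\in C^2(\mathbb{R})$ such that $f$ and $\mathfrak{R}f$ belong to $L^2(\mu_\infty)$. It is well defined on classes of functions modulo $\mu_\infty$-null sets, and densely defined. Let $\mathfrak{R}^\star$ be its Hilbert space adjoint. Then, for every $g\in C^2(\mathbb{R})\cap L^2(\mu_\infty)$, $g$ belongs to the domain of $\mathfrak{R}^\star$ if and only if $\mathfrak{R} g+\theta g'-xg\in L^2(\mu_\infty)$, and in this case $$(\mathfrak{R}^\star g)(x) = (\mathfrak{R} g)(x) + \theta(x) g'(x) - x\,g(x)\qquad\text{for } \mu_\infty\text{-almost every } x.$$ Here $$\theta(x) = \mathbb{E}\bigl(N_1^2+N_2^2 \,\big|\, N_1N_2=x\bigr) = 2|x|\,\frac{K_1(|x|)}{K_0(|x|)}\qquad\text{for } \mu_\infty\text{-almost every } x,$$ where $K_\nu(x)=\int_0^\infty e^{-x\cosh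 t}\cosh(\nu t)\,dt$ $(x>0)$ is the modified Bessel function of the second kind. -/

import Mathlib

open MeasureTheory ProbabilityTheory

namespace NormalProduct

/-- The modified Bessel function of the second kind with real index `ν`, at `x > 0`:
`K_ν(x) = ∫_0^∞ exp(-x cosh t) cosh(ν t) dt`. -/
noncomputable def besselK (ν x : ℝ) : ℝ :=
  ∫ t in Set.Ioi (0 : ℝ), Real.exp (-x * Real.cosh t) * Real.cosh (ν * t)

/-- `θ(x) = 2 |x| K_1(|x|) / K_0(|x|)` (for `x ≠ 0`). -/
noncomputable def theta (x : ℝ) : ℝ :=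
  2 * |x| * (besselK 1 |x| / besselK 0 |x|)

/-- The differential expression `(R f)(x) = x f(x) - f'(x) - x f''(x)`. -/
noncomputable def steinR (f : ℝ → ℝ) (x : ℝ) : ℝ :=
  x * f x - deriv f x - x * deriv (deriv f) x

/-- The differential expression `(R g)(x) + θ(x) g'(x) - x g(x)`. -/
noncomputable def steinRAdj (g : ℝ → ℝ) (x : ℝ) : ℝ :=
  steinR g x + theta x * deriv g x - x * g x

theorem steinR_add {f g : ℝ → ℝ} (hf : ContDiff ℝ 2 f) (hg : ContDiff ℝ 2 g) (x : ℝ) :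
    steinR (f + g) x = steinR f x + steinR g x := by
  have hf1 : Differentiable ℝ f := hf.differentiable (by norm_num)
  have hg1 : Differentiable ℝ g := hg.differentiable (by norm_num)
  have hf2 : Differentiable ℝ (deriv f) := by
    simpa using hf.differentiable_iteratedDeriv 1 (by norm_num)
  have hg2 : Differentiable ℝ (deriv g) := by
    simpa using hg.differentiable_iteratedDeriv 1 (by norm_num)
  have h1 : deriv (f + g) = deriv f + deriv g := funext fun y => deriv_add (hf1 y) (hg1 y)
  have h2 : deriv (deriv f + deriv g) x = deriv (deriv f) x + deriv (deriv g) x :=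
    deriv_add (hf2 x) (hg2 x)
  simp only [steinR, h1, h2, Pi.add_apply]
  ring

theorem steinR_smul (c : ℝ) (f : ℝ → ℝ) (x : ℝ) :
    steinR (c • f) x = c * steinR f x := by
  have h1 : ∀ u : ℝ → ℝ, deriv (c • u) = c • deriv u := fun u =>
    funext fun y => by rw [deriv_const_smul_field, Pi.smul_apply]
  simp only [steinR, h1, Pi.smul_apply, smul_eq_mul]
  ring

/-- The graph in `L²(μ) × L²(μ)` of the differential operator `R` on its natural domain: all pairs
of classes of `f` and of `R f`, for `f` of class `C²` with both `f` and `R f` in `L²(μ)`. -/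
def steinGraph (μ : Measure ℝ) : Submodule ℝ (Lp ℝ 2 μ × Lp ℝ 2 μ) where
  carrier := {p | ∃ f : ℝ → ℝ, ContDiff ℝ 2 f ∧ p.1 =ᵐ[μ] f ∧ p.2 =ᵐ[μ] steinR f}
  zero_mem' := by
    refine ⟨0, contDiff_const, Lp.coeFn_zero ℝ 2 μ, ?_⟩
    filter_upwards [Lp.coeFn_zero ℝ 2 μ] with x hx
    have h := steinR_smul 0 0 x
    simp only [zero_smul, zero_mul] at h
    rw [h]
    exact hx
  add_mem' := by
    rintro p q ⟨f, hf, hp1, hp2⟩ ⟨g, hg, hq1, hq2⟩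
    refine ⟨f + g, hf.add hg, ?_, ?_⟩
    · filter_upwards [Lp.coeFn_add p.1 q.1, hp1, hq1] with x h h1 h2
      rw [Prod.fst_add, h, Pi.add_apply, Pi.add_apply, h1, h2]
    · filter_upwards [Lp.coeFn_add p.2 q.2, hp2, hq2] with x h h1 h2
      rw [Prod.snd_add, h, Pi.add_apply, h1, h2, steinR_add hf hg]
  smul_mem' := by
    rintro c p ⟨f, hf, hp1, hp2⟩
    refine ⟨c • f, hf.const_smul c, ?_, ?_⟩
    · filter_upwards [Lp.coeFn_smul c p.1, hp1] with x h h1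
      simp [h, h1]
    · filter_upwards [Lp.coeFn_smul c p.2, hp2] with x h h1
      simp [h, h1, steinR_smul]

/-- The operator `R` in `L²(μ)`, as a partially defined linear operator with graph
`steinGraph μ` (when this is the graph of a function). -/
noncomputable def steinOp (μ : Measure ℝ) : Lp ℝ 2 μ →ₗ.[ℝ] Lp ℝ 2 μ :=
  (steinGraph μ).toLinearPMap

end NormalProduct

/-! Density and θ. On each half `x > 0`, `x < 0` of the plane, use the coordinates `z = xy` and `s`
with `x = ±√|z| e^{s/2}`. Then `dx dy = ½ ds dz` and `x² + y² = 2|z| cosh s`, so the Gaussian weight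
becomes `e^{-|z| cosh s}`. Integrating out `s` gives the density `K₀(|z|)/π`, and averaging `2|z|
cosh s` gives `θ`.

Adjoint. Since `R f = x f - (x f')'` is formally symmetric for `dx`, its formal adjoint for the
weight `K₀(|x|)` is `K₀⁻¹ R (K₀ g)`; Bessel's equation turns this into `R g + θ g' - x g`. On `(0,
∞)` Lagrange's identity gives `(R f · g - f · R⋆g) K₀ = W'` with `W = x (f (g K₀)' - f' g K₀)`
(`hasDerivAt_boundaryForm`). Three boundary contributions remain. At `0`, `x K₁ → 1` and `x K₀ → 0`
give `W → -f(0) g(0)`, which the reflection `x ↦ -x` cancels against the negative half-line. At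
`±∞`, `W` has a limit because `W'` is integrable. An energy estimate
(`integrableOn_deriv_sq_mul_weight`) puts `f'` in `L²(K₀)` and `(g K₀)'` in `L²(1/K₀)`, so `W/x` is
integrable and the limit must be `0` (`tendsto_boundaryForm_atTop`). Hence `R⋆g ∈ L²` puts `g` in
the adjoint domain. Conversely, testing against smooth compactly supported functions identifies the
adjoint with the differential expression almost everywhere, and so forces that expression into `L²`.
-/

namespace NormalProduct

open Set Filter Topology

/-! ### Bessel functions: derivatives, bounds, behaviour at 0 -/

theorem one_add_sq_div_two_le_cosh {t : ℝ} (ht : 0 ≤ t) : 1 + t ^ 2 / 2 ≤ Real.cosh t := by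
  have h1 : Real.cosh t = 1 + 2 * Real.sinh (t / 2) ^ 2 := by
    have h := Real.cosh_two_mul (t / 2)
    have h2 := Real.cosh_sq (t / 2)
    rw [show 2 * (t / 2) = t by ring] at h
    linarith
  have h3 : t / 2 ≤ Real.sinh (t / 2) := Real.self_le_sinh_iff.2 (by linarith)
  have h4 : (t / 2) ^ 2 ≤ Real.sinh (t / 2) ^ 2 := pow_le_pow_left₀ (by linarith) h3 2
  rw [h1]
  nlinarith

theorem self_le_cosh {t : ℝ} (ht : 0 ≤ t) : t ≤ Real.cosh t := by
  nlinarith [one_add_sq_div_two_le_cosh ht, sq_nonneg (t - 1)]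

/-- The integral `∫_0^∞ exp(-x cosh t) (cosh t)^n dt`. -/
noncomputable def coshMoment (n : ℕ) (x : ℝ) : ℝ :=
  ∫ t in Ioi (0 : ℝ), Real.exp (-x * Real.cosh t) * Real.cosh t ^ n

theorem besselK_zero_eq (x : ℝ) : besselK 0 x = coshMoment 0 x := by
  simp [besselK, coshMoment]

theorem besselK_one_eq (x : ℝ) : besselK 1 x = coshMoment 1 x := by
  simp [besselK, coshMoment]

/-- Half of the exponent absorbs the power, by `y ^ n / n! ≤ e^y` at `y = (x / 2) cosh t`; the other
half decays because `cosh t ≥ t`. -/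
theorem exp_mul_cosh_pow_le (n : ℕ) {x t : ℝ} (hx : 0 < x) (ht : 0 ≤ t) :
    Real.exp (-x * Real.cosh t) * Real.cosh t ^ n ≤
      n.factorial * (2 / x) ^ n * Real.exp (-(x / 2) * t) := by
  have hc : 0 ≤ x / 2 * Real.cosh t := by positivity
  have h1 := Real.pow_div_factorial_le_exp _ hc n
  have hf : (0 : ℝ) < n.factorial := by positivity
  rw [div_le_iff₀ hf, mul_pow] at h1
  have h2 : Real.cosh t ^ n ≤
      n.factorial * (2 / x) ^ n * Real.exp (x / 2 * Real.cosh t) := by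
    have h3 : (2 / x) ^ n * (x / 2) ^ n = 1 := by
      rw [← mul_pow]
      have : 2 / x * (x / 2) = 1 := by field_simp
      rw [this, one_pow]
    have h4 : (0 : ℝ) ≤ (2 / x) ^ n := by positivity
    calc Real.cosh t ^ n = (2 / x) ^ n * ((x / 2) ^ n * Real.cosh t ^ n) := by
          rw [← mul_assoc, h3, one_mul]
      _ ≤ (2 / x) ^ n * (Real.exp (x / 2 * Real.cosh t) * n.factorial) := by gcongr
      _ = _ := by ring
  calc Real.exp (-x * Real.cosh t) * Real.cosh t ^ n
      ≤ Real.exp (-x * Real.cosh t) *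
        (n.factorial * (2 / x) ^ n * Real.exp (x / 2 * Real.cosh t)) := by gcongr
    _ = n.factorial * (2 / x) ^ n * Real.exp (-(x / 2) * Real.cosh t) := by
        rw [show -(x / 2) * Real.cosh t = -x * Real.cosh t + x / 2 * Real.cosh t by ring,
          Real.exp_add]
        ring
    _ ≤ _ := by
        gcongr n.factorial * (2 / x) ^ n * Real.exp ?_
        nlinarith [self_le_cosh ht]

theorem continuous_exp_mul_cosh_pow (n : ℕ) (x : ℝ) :
    Continuous fun t : ℝ => Real.exp (-x * Real.cosh t) * Real.cosh t ^ n := by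
  have := Real.continuous_cosh
  fun_prop

theorem integrableOn_exp_mul_cosh_pow (n : ℕ) {x : ℝ} (hx : 0 < x) :
    IntegrableOn (fun t => Real.exp (-x * Real.cosh t) * Real.cosh t ^ n) (Ioi 0) := by
  refine Integrable.mono'
    ((exp_neg_integrableOn_Ioi 0 (half_pos hx)).const_mul (n.factorial * (2 / x) ^ n))
    (continuous_exp_mul_cosh_pow n x).aestronglyMeasurable ?_
  filter_upwards [ae_restrict_mem measurableSet_Ioi] with t ht
  rw [Real.norm_of_nonneg (by positivity)]
  exact exp_mul_cosh_pow_le n hx (le_of_lt ht)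

theorem hasDerivAt_coshMoment (n : ℕ) {x : ℝ} (hx : 0 < x) :
    HasDerivAt (coshMoment n) (-coshMoment (n + 1) x) x := by
  have h := (hasDerivAt_integral_of_dominated_loc_of_deriv_le (𝕜 := ℝ) (x₀ := x)
    (μ := volume.restrict (Ioi (0 : ℝ))) (s := Ioi (x / 2))
    (F := fun y t => Real.exp (-y * Real.cosh t) * Real.cosh t ^ n)
    (F' := fun y t => -(Real.exp (-y * Real.cosh t) * Real.cosh t ^ (n + 1)))
    (bound := fun t => Real.exp (-(x / 2) * Real.cosh t) * Real.cosh t ^ (n + 1))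
    (Ioi_mem_nhds (by linarith))
    (Eventually.of_forall fun y => (continuous_exp_mul_cosh_pow n y).aestronglyMeasurable)
    (integrableOn_exp_mul_cosh_pow n hx)
    (continuous_exp_mul_cosh_pow (n + 1) x).neg.aestronglyMeasurable
    (Eventually.of_forall fun t y hy => ?_)
    (integrableOn_exp_mul_cosh_pow (n + 1) (half_pos hx))
    (Eventually.of_forall fun t y _ => ?_)).2
  · rw [integral_neg] at h
    exact h
  · rw [norm_neg, Real.norm_of_nonneg (by positivity)]
    have : x / 2 < y := hy
    have hc := Real.cosh_pos t
    gcongr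
  · have h1 : HasDerivAt (fun y : ℝ => -y * Real.cosh t) (-1 * Real.cosh t) y :=
      (hasDerivAt_neg y).mul_const _
    convert! h1.exp.mul_const (Real.cosh t ^ n) using 1
    ring

theorem coshMoment_pos (n : ℕ) {x : ℝ} (hx : 0 < x) : 0 < coshMoment n x := by
  refine (setIntegral_pos_iff_support_of_nonneg_ae ?_ (integrableOn_exp_mul_cosh_pow n hx)).2 ?_
  · exact Eventually.of_forall fun t => by
      simp only [Pi.zero_apply]
      positivity
  · have : Function.support (fun t => Real.exp (-x * Real.cosh t) * Real.cosh t ^ n) = univ := by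
      ext t
      simp [(Real.cosh_pos t).ne']
    rw [this, univ_inter]
    simp

theorem tendsto_sinh_mul_exp {x : ℝ} (hx : 0 < x) :
    Tendsto (fun t => Real.sinh t * Real.exp (-x * Real.cosh t)) atTop (𝓝 0) := by
  have h0 : Tendsto (fun t : ℝ => (1 : ℕ).factorial * (2 / x) ^ 1 * Real.exp (-(x / 2) * t))
      atTop (𝓝 0) := by
    rw [← mul_zero ((1 : ℕ).factorial * (2 / x) ^ 1 : ℝ)]
    refine Tendsto.const_mul _ (Real.tendsto_exp_atBot.comp ?_)
    exact tendsto_id.const_mul_atTop_of_neg (by linarith)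
  refine squeeze_zero' ?_ ?_ h0
  · filter_upwards [eventually_ge_atTop 0] with t ht
    exact mul_nonneg (Real.sinh_nonneg_iff.2 ht) (Real.exp_pos _).le
  · filter_upwards [eventually_ge_atTop 0] with t ht
    refine le_trans ?_ (exp_mul_cosh_pow_le 1 hx ht)
    rw [pow_one, mul_comm]
    have := (Real.sinh_lt_cosh t).le
    gcongr

/-- The derivative of `sinh t · e^{-x cosh t}` integrates to zero over the half-line; expand it with
`sinh² = cosh² - 1`. This is Bessel's equation in integrated form. -/
theorem coshMoment_recurrence {x : ℝ} (hx : 0 < x) :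
    x * coshMoment 2 x = x * coshMoment 0 x + coshMoment 1 x := by
  have h0 := integrableOn_exp_mul_cosh_pow 0 hx
  have h1 := integrableOn_exp_mul_cosh_pow 1 hx
  have h2 := integrableOn_exp_mul_cosh_pow 2 hx
  have hi : IntegrableOn (fun t => Real.exp (-x * Real.cosh t) * Real.cosh t ^ 1 -
      x * (Real.exp (-x * Real.cosh t) * Real.cosh t ^ 2) +
      x * (Real.exp (-x * Real.cosh t) * Real.cosh t ^ 0)) (Ioi 0) :=
    (h1.sub (h2.const_mul x)).add (h0.const_mul x)
  have h := integral_Ioi_of_hasDerivAt_of_tendsto' (a := 0) (m := 0)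
    (f := fun t => Real.sinh t * Real.exp (-x * Real.cosh t)) (fun t _ => ?_) hi
    (tendsto_sinh_mul_exp hx)
  · have h12 : IntegrableOn (fun t => Real.exp (-x * Real.cosh t) * Real.cosh t ^ 1 -
        x * (Real.exp (-x * Real.cosh t) * Real.cosh t ^ 2)) (Ioi 0) := h1.sub (h2.const_mul x)
    rw [integral_add h12 (h0.const_mul x),
      integral_sub h1 (h2.const_mul x), integral_const_mul, integral_const_mul] at h
    simp only [Real.sinh_zero, zero_mul, sub_zero] at h
    unfold coshMoment
    linarith
  · have hd := (Real.hasDerivAt_sinh t).mul (((Real.hasDerivAt_cosh t).const_mul (-x)).exp)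
    convert! hd using 1
    have := Real.cosh_sq t
    rw [this]
    ring

theorem hasDerivAt_besselK_zero {x : ℝ} (hx : 0 < x) :
    HasDerivAt (besselK 0) (-besselK 1 x) x := by
  rw [funext besselK_zero_eq, besselK_one_eq]
  exact hasDerivAt_coshMoment 0 hx

theorem hasDerivAt_besselK_one {x : ℝ} (hx : 0 < x) :
    HasDerivAt (besselK 1) (-(besselK 0 x + besselK 1 x / x)) x := by
  have h := hasDerivAt_coshMoment 1 hx
  rw [funext besselK_one_eq, besselK_zero_eq]
  convert! h using 2
  have := coshMoment_recurrence hx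
  field_simp
  linarith

theorem besselK_zero_pos {x : ℝ} (hx : 0 < x) : 0 < besselK 0 x := by
  rw [besselK_zero_eq]
  exact coshMoment_pos 0 hx

theorem besselK_one_pos {x : ℝ} (hx : 0 < x) : 0 < besselK 1 x := by
  rw [besselK_one_eq]
  exact coshMoment_pos 1 hx

theorem continuousOn_besselK_zero : ContinuousOn (besselK 0) (Ioi 0) := fun _ hx =>
  (hasDerivAt_besselK_zero hx).continuousAt.continuousWithinAt

theorem continuousOn_besselK_one : ContinuousOn (besselK 1) (Ioi 0) := fun _ hx =>
  (hasDerivAt_besselK_one hx).continuousAt.continuousWithinAt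

/-- Chebyshev's argument: the constant `C` is the mean of `cosh t` under the weight `e^{-cosh t}`,
and the extra factor `e^{-(x-1) cosh t}`, decreasing in `cosh t`, can only lower that mean. The
result bounds the logarithmic derivatives of both weights `K₀` and `1/K₀` on `[1, ∞)`. -/
theorem besselK_one_le_mul_besselK_zero {x : ℝ} (hx : 1 ≤ x) :
    besselK 1 x ≤ besselK 1 1 / besselK 0 1 * besselK 0 x := by
  set C := besselK 1 1 / besselK 0 1 with hC
  have h0 := integrableOn_exp_mul_cosh_pow 0 (zero_lt_one.trans_le hx)
  have h1 := integrableOn_exp_mul_cosh_pow 1 (zero_lt_one.trans_le hx)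
  have g0 := integrableOn_exp_mul_cosh_pow 0 zero_lt_one
  have g1 := integrableOn_exp_mul_cosh_pow 1 zero_lt_one
  have key : ∫ t in Ioi (0 : ℝ), (Real.exp (-x * Real.cosh t) * Real.cosh t ^ 1 -
      C * (Real.exp (-x * Real.cosh t) * Real.cosh t ^ 0)) ≤
      ∫ t in Ioi (0 : ℝ), Real.exp (-(x - 1) * C) *
        (Real.exp (-1 * Real.cosh t) * Real.cosh t ^ 1 -
          C * (Real.exp (-1 * Real.cosh t) * Real.cosh t ^ 0)) := by
    refine integral_mono (h1.sub (h0.const_mul C)) ((g1.sub (g0.const_mul C)).const_mul _)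
      fun t => ?_
    simp only [pow_one, pow_zero, mul_one]
    have e1 : Real.exp (-x * Real.cosh t) =
        Real.exp (-1 * Real.cosh t) * Real.exp (-(x - 1) * Real.cosh t) := by
      rw [← Real.exp_add]
      ring_nf
    -- The two factors are oppositely monotone in `cosh t` and both vanish at `cosh t = C`.
    have e2 : (Real.exp (-(x - 1) * Real.cosh t) - Real.exp (-(x - 1) * C)) *
        (Real.cosh t - C) ≤ 0 := by
      rcases le_total (Real.cosh t) C with h | h
      · refine mul_nonpos_of_nonneg_of_nonpos (sub_nonneg.2 (Real.exp_le_exp.2 ?_)) (by linarith)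
        nlinarith
      · refine mul_nonpos_of_nonpos_of_nonneg (sub_nonpos.2 (Real.exp_le_exp.2 ?_)) (by linarith)
        nlinarith
    rw [e1]
    nlinarith [Real.exp_pos (-1 * Real.cosh t)]
  rw [integral_const_mul, integral_sub h1 (h0.const_mul C), integral_const_mul,
    integral_sub g1 (g0.const_mul C), integral_const_mul] at key
  change coshMoment 1 x - C * coshMoment 0 x ≤
    Real.exp (-(x - 1) * C) * (coshMoment 1 1 - C * coshMoment 0 1) at key
  rw [← besselK_zero_eq, ← besselK_zero_eq, ← besselK_one_eq, ← besselK_one_eq, hC,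
    div_mul_cancel₀ _ (besselK_zero_pos one_pos).ne', sub_self, mul_zero] at key
  linarith

/-- With `sinh` in place of `cosh` the integrand of `K₁` has an explicit antiderivative. As `0 ≤
cosh t - sinh t = e^{-t}`, this traps `x K₁(x)` between `e^{-x}` and `e^{-x} + x`. -/
theorem integral_sinh_mul_exp {x : ℝ} (hx : 0 < x) :
    IntegrableOn (fun t => Real.sinh t * Real.exp (-x * Real.cosh t)) (Ioi 0) ∧
      x * ∫ t in Ioi (0 : ℝ), Real.sinh t * Real.exp (-x * Real.cosh t) = Real.exp (-x) := by
  have hi : IntegrableOn (fun t => Real.sinh t * Real.exp (-x * Real.cosh t)) (Ioi 0) := by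
    have hc : Continuous fun t => Real.sinh t * Real.exp (-x * Real.cosh t) := by
      have := Real.continuous_cosh
      have := Real.continuous_sinh
      fun_prop
    refine Integrable.mono' (integrableOn_exp_mul_cosh_pow 1 hx) hc.aestronglyMeasurable ?_
    filter_upwards [ae_restrict_mem measurableSet_Ioi] with t ht
    have h1 := Real.sinh_nonneg_iff.2 (le_of_lt ht)
    rw [Real.norm_of_nonneg (by positivity), pow_one, mul_comm]
    have := (Real.sinh_lt_cosh t).le
    gcongr
  refine ⟨hi, ?_⟩
  have hlim : Tendsto (fun t => -Real.exp (-x * Real.cosh t)) atTop (𝓝 (-0)) := by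
    refine Tendsto.neg (squeeze_zero' (g := fun t => Real.sinh t * Real.exp (-x * Real.cosh t))
      (Eventually.of_forall fun t => (Real.exp_pos _).le) ?_ (tendsto_sinh_mul_exp hx))
    filter_upwards [eventually_ge_atTop 1] with t ht
    have h1 : 1 ≤ Real.sinh t := ht.trans (Real.self_le_sinh_iff.2 (by linarith))
    nlinarith [Real.exp_pos (-x * Real.cosh t)]
  have h := integral_Ioi_of_hasDerivAt_of_tendsto' (a := 0)
    (f := fun t => -Real.exp (-x * Real.cosh t)) (fun t _ => ?_) (hi.const_mul x) hlim
  · rw [integral_const_mul] at h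
    rw [h]
    simp
  · convert! (((Real.hasDerivAt_cosh t).const_mul (-x)).exp).neg using 1
    ring

theorem exp_neg_le_mul_besselK_one {x : ℝ} (hx : 0 < x) : Real.exp (-x) ≤ x * besselK 1 x := by
  obtain ⟨hi, he⟩ := integral_sinh_mul_exp hx
  rw [← he, besselK_one_eq]
  refine mul_le_mul_of_nonneg_left (integral_mono hi (integrableOn_exp_mul_cosh_pow 1 hx)
    fun t => ?_) hx.le
  simp only [pow_one]
  rw [mul_comm]
  have := (Real.sinh_lt_cosh t).le
  gcongr

theorem mul_besselK_one_le {x : ℝ} (hx : 0 < x) : x * besselK 1 x ≤ Real.exp (-x) + x := by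
  obtain ⟨hi, he⟩ := integral_sinh_mul_exp hx
  have hj : IntegrableOn (fun t : ℝ => Real.exp (-t)) (Ioi 0) := by
    simpa using exp_neg_integrableOn_Ioi 0 zero_lt_one
  have hk : besselK 1 x ≤
      (∫ t in Ioi (0 : ℝ), Real.sinh t * Real.exp (-x * Real.cosh t)) + 1 := by
    rw [besselK_one_eq, ← integral_exp_neg_Ioi_zero, ← integral_add hi hj]
    refine integral_mono (integrableOn_exp_mul_cosh_pow 1 hx) (hi.add hj) fun t => ?_
    simp only [pow_one]
    have h1 : Real.cosh t = Real.sinh t + Real.exp (-t) := by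
      rw [← Real.cosh_sub_sinh]
      ring
    have h2 : Real.exp (-x * Real.cosh t) ≤ 1 :=
      Real.exp_le_one_iff.2 (by nlinarith [Real.cosh_pos t])
    nlinarith [Real.exp_pos (-t)]
  nlinarith

theorem tendsto_mul_besselK_one :
    Tendsto (fun x => x * besselK 1 x) (𝓝[>] 0) (𝓝 1) := by
  have h1 : Tendsto (fun x : ℝ => Real.exp (-x)) (𝓝[>] 0) (𝓝 1) := by
    have : Continuous fun x : ℝ => Real.exp (-x) := by fun_prop
    simpa using (this.tendsto 0).mono_left nhdsWithin_le_nhds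
  have h2 : Tendsto (fun x : ℝ => Real.exp (-x) + x) (𝓝[>] 0) (𝓝 1) := by
    have : Continuous fun x : ℝ => Real.exp (-x) + x := by fun_prop
    simpa using (this.tendsto 0).mono_left nhdsWithin_le_nhds
  refine tendsto_of_tendsto_of_tendsto_of_le_of_le' h1 h2 ?_ ?_
  · filter_upwards [self_mem_nhdsWithin] with x hx using exp_neg_le_mul_besselK_one hx
  · filter_upwards [self_mem_nhdsWithin] with x hx using mul_besselK_one_le hx

/-- The bound `cosh t ≥ 1 + t²/2` dominates `K₀` by half a Gaussian integral. The true singularity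
is logarithmic, but `√x` suffices for `x K₀ → 0`. -/
theorem mul_besselK_zero_le {x : ℝ} (hx : 0 < x) :
    x * besselK 0 x ≤ √(Real.pi / 2) * √x := by
  have hi := (integrable_exp_neg_mul_sq (half_pos hx)).integrableOn (s := Ioi 0)
  have h1 : besselK 0 x ≤ √(Real.pi / (x / 2)) / 2 := by
    rw [← integral_gaussian_Ioi, besselK_zero_eq]
    refine setIntegral_mono_on (integrableOn_exp_mul_cosh_pow 0 hx) hi measurableSet_Ioi
      fun t ht => ?_
    rw [pow_zero, mul_one]
    refine Real.exp_le_exp.2 ?_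
    nlinarith [one_add_sq_div_two_le_cosh (le_of_lt ht)]
  have h2 : x * (√(Real.pi / (x / 2)) / 2) = √(Real.pi / 2) * √x := by
    rw [← Real.sqrt_mul (by positivity)]
    symm
    rw [Real.sqrt_eq_iff_mul_self_eq (by positivity) (by positivity)]
    have h3 := Real.mul_self_sqrt (show 0 ≤ Real.pi / (x / 2) by positivity)
    symm
    calc x * (√(Real.pi / (x / 2)) / 2) * (x * (√(Real.pi / (x / 2)) / 2))
        = x ^ 2 / 4 * (√(Real.pi / (x / 2)) * √(Real.pi / (x / 2))) := by ring
      _ = Real.pi / 2 * x := by rw [h3]; field_simp; ring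
  rw [← h2]
  gcongr

theorem tendsto_mul_besselK_zero :
    Tendsto (fun x => x * besselK 0 x) (𝓝[>] 0) (𝓝 0) := by
  have h : Tendsto (fun x : ℝ => √(Real.pi / 2) * √x) (𝓝[>] 0) (𝓝 0) := by
    have : Continuous fun x : ℝ => √(Real.pi / 2) * √x := by fun_prop
    simpa using (this.tendsto 0).mono_left nhdsWithin_le_nhds
  refine squeeze_zero' ?_ ?_ h
  · filter_upwards [self_mem_nhdsWithin] with x hx
    exact mul_nonneg (le_of_lt hx) (besselK_zero_pos hx).le
  · filter_upwards [self_mem_nhdsWithin] with x hx using mul_besselK_zero_le hx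

theorem measurable_besselK (ν : ℝ) : Measurable (besselK ν) := by
  have hc : Continuous fun p : ℝ × ℝ => Real.exp (-p.1 * Real.cosh p.2) * Real.cosh (ν * p.2) := by
    have := Real.continuous_cosh
    fun_prop
  exact (hc.stronglyMeasurable.integral_prod_right'
    (ν := volume.restrict (Ioi (0 : ℝ)))).measurable

theorem measurable_theta : Measurable theta := by
  have ha : Measurable fun x : ℝ => |x| := measurable_norm
  exact (ha.const_mul 2).mul (((measurable_besselK 1).comp ha).div ((measurable_besselK 0).comp ha))

/-! ### Change of variables to the product and a hyperbolic parameter -/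

theorem sq_add_div_sq_eq_cosh {c z : ℝ} (hc : c ≠ 0) (hcz : c ^ 2 = |z|) (s : ℝ) :
    (c * Real.exp (s / 2)) ^ 2 + (z / (c * Real.exp (s / 2))) ^ 2 = 2 * |z| * Real.cosh s := by
  have h1 : Real.exp (s / 2) ^ 2 = Real.exp s := by
    rw [← Real.exp_nat_mul]
    congr 1
    push_cast
    ring
  have h2 : z ^ 2 = |z| ^ 2 := (sq_abs z).symm
  have hz : |z| ≠ 0 := by rw [← hcz]; positivity
  rw [div_pow, mul_pow, h1, hcz, h2, Real.cosh_eq, Real.exp_neg]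
  have := (Real.exp_pos s).ne'
  field_simp

/-- One branch of the substitution: `c = √|z|` covers `x > 0` and `c = -√|z|` covers `x < 0`. Since
`dx / |x| = ds / 2`, each contributes half of the total. -/
theorem lintegral_image_mul_exp {c z : ℝ} (hc : c ≠ 0) (hcz : c ^ 2 = |z|)
    (G : ℝ → ENNReal) :
    ∫⁻ x in (fun s : ℝ => c * Real.exp (s / 2)) '' univ,
        ENNReal.ofReal |x|⁻¹ * G (x ^ 2 + (z / x) ^ 2) =
      ∫⁻ s, ENNReal.ofReal (1 / 2) * G (2 * |z| * Real.cosh s) := by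
  have hd : ∀ s ∈ univ, HasDerivWithinAt (fun s : ℝ => c * Real.exp (s / 2))
      (c * (Real.exp (s / 2) * (1 / 2))) univ s := fun s _ =>
    ((((hasDerivAt_id s).div_const 2).exp).const_mul c).hasDerivWithinAt
  have hinj : InjOn (fun s : ℝ => c * Real.exp (s / 2)) univ := fun s _ t _ h => by
    have := Real.exp_injective (mul_left_cancel₀ hc h)
    linarith
  rw [lintegral_image_eq_lintegral_abs_deriv_mul MeasurableSet.univ hd hinj, Measure.restrict_univ]
  refine lintegral_congr fun s => ?_
  rw [sq_add_div_sq_eq_cosh hc hcz, ← mul_assoc, ← ENNReal.ofReal_mul (abs_nonneg _)]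
  congr 2
  have : |c * Real.exp (s / 2)| ≠ 0 := by positivity
  rw [← mul_assoc, abs_mul (c * Real.exp (s / 2)), mul_comm, ← mul_assoc, inv_mul_cancel₀ this]
  norm_num

theorem image_mul_exp_of_pos {c : ℝ} (hc : 0 < c) :
    (fun s : ℝ => c * Real.exp (s / 2)) '' univ = Ioi 0 := by
  ext x
  constructor
  · rintro ⟨s, -, rfl⟩
    exact mul_pos hc (Real.exp_pos _)
  · intro hx
    have hx' : 0 < x / c := div_pos hx hc
    refine ⟨2 * Real.log (x / c), mem_univ _, ?_⟩
    simp only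
    rw [mul_div_cancel_left₀ _ (two_ne_zero' ℝ), Real.exp_log hx', mul_div_cancel₀ _ hc.ne']

theorem image_mul_exp_of_neg {c : ℝ} (hc : c < 0) :
    (fun s : ℝ => c * Real.exp (s / 2)) '' univ = Iio 0 := by
  ext x
  constructor
  · rintro ⟨s, -, rfl⟩
    exact mul_neg_of_neg_of_pos hc (Real.exp_pos _)
  · intro hx
    have hx' : 0 < x / c := div_pos_of_neg_of_neg hx hc
    refine ⟨2 * Real.log (x / c), mem_univ _, ?_⟩
    simp only
    rw [mul_div_cancel_left₀ _ (two_ne_zero' ℝ), Real.exp_log hx', mul_div_cancel₀ _ hc.ne]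

theorem lintegral_inv_mul_sq_add_div_sq {z : ℝ} (hz : z ≠ 0) {G : ℝ → ENNReal}
    (hG : Measurable G) :
    ∫⁻ x : ℝ, ENNReal.ofReal |x|⁻¹ * G (x ^ 2 + (z / x) ^ 2) =
      ∫⁻ s, G (2 * |z| * Real.cosh s) := by
  have hpos : 0 < √|z| := Real.sqrt_pos.2 (abs_pos.2 hz)
  have hsq : √|z| ^ 2 = |z| := Real.sq_sqrt (abs_nonneg z)
  have h1 := lintegral_image_mul_exp hpos.ne' hsq G
  have h2 := lintegral_image_mul_exp (neg_ne_zero.2 hpos.ne') ((neg_sq _).trans hsq) G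
  rw [image_mul_exp_of_pos hpos] at h1
  rw [image_mul_exp_of_neg (neg_neg_of_pos hpos), setLIntegral_congr Iio_ae_eq_Iic] at h2
  have hm : Measurable fun s => G (2 * |z| * Real.cosh s) :=
    hG.comp (Real.measurable_cosh.const_mul _)
  rw [← lintegral_add_compl _ (measurableSet_Ioi (a := (0 : ℝ))), compl_Ioi, h1, h2,
    ← lintegral_add_left (hm.const_mul _)]
  refine lintegral_congr fun s => ?_
  rw [← add_mul, ← ENNReal.ofReal_add (by norm_num) (by norm_num)]
  norm_num

theorem lintegral_comp_div {x : ℝ} (hx : x ≠ 0) {H : ℝ → ENNReal} (hH : Measurable H) :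
    ∫⁻ y, H y = ∫⁻ z, ENNReal.ofReal |x|⁻¹ * H (z / x) := by
  have h := lintegral_map (μ := volume) hH (measurable_const_mul x⁻¹)
  rw [Real.map_volume_mul_left (inv_ne_zero hx), lintegral_smul_measure, inv_inv] at h
  have hm : Measurable fun z => H (z / x) := hH.comp (measurable_id.div_const x)
  rw [lintegral_const_mul _ hm]
  simp only [div_eq_inv_mul]
  rw [← h, smul_eq_mul, ← mul_assoc, ← ENNReal.ofReal_mul (by positivity),
    inv_mul_cancel₀ (abs_ne_zero.2 hx), ENNReal.ofReal_one, one_mul]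

theorem lintegral_lintegral_mul_sq_add_sq {φ G : ℝ → ENNReal} (hφ : Measurable φ)
    (hG : Measurable G) :
    ∫⁻ x : ℝ, ∫⁻ y : ℝ, φ (x * y) * G (x ^ 2 + y ^ 2) =
      ∫⁻ z, φ z * ∫⁻ s, G (2 * |z| * Real.cosh s) := by
  calc ∫⁻ x : ℝ, ∫⁻ y : ℝ, φ (x * y) * G (x ^ 2 + y ^ 2)
      = ∫⁻ x : ℝ, ∫⁻ z : ℝ, φ z * (ENNReal.ofReal |x|⁻¹ * G (x ^ 2 + (z / x) ^ 2)) := by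
        refine lintegral_congr_ae ?_
        filter_upwards [Measure.ae_ne volume 0] with x hx
        rw [lintegral_comp_div hx (by fun_prop)]
        refine lintegral_congr fun z => ?_
        rw [mul_div_cancel₀ _ hx]
        ring
    _ = ∫⁻ z : ℝ, ∫⁻ x : ℝ, φ z * (ENNReal.ofReal |x|⁻¹ * G (x ^ 2 + (z / x) ^ 2)) :=
        lintegral_lintegral_swap (by fun_prop)
    _ = _ := by
        refine lintegral_congr_ae ?_
        filter_upwards [Measure.ae_ne volume 0] with z hz
        rw [lintegral_const_mul _ (by fun_prop), lintegral_inv_mul_sq_add_div_sq hz hG]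

/-! ### The law of the product and the conditional expectation -/

theorem gaussianPDF_mul_gaussianPDF (x y : ℝ) :
    gaussianPDF 0 1 x * gaussianPDF 0 1 y =
      ENNReal.ofReal ((2 * Real.pi)⁻¹ * Real.exp (-(x ^ 2 + y ^ 2) / 2)) := by
  rw [gaussianPDF, gaussianPDF, ← ENNReal.ofReal_mul (gaussianPDFReal_nonneg 0 1 x)]
  congr 1
  simp only [gaussianPDFReal, NNReal.coe_one, mul_one, sub_zero]
  have h : √(2 * Real.pi) * √(2 * Real.pi) = 2 * Real.pi := Real.mul_self_sqrt (by positivity)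
  calc (√(2 * Real.pi))⁻¹ * Real.exp (-x ^ 2 / 2) * ((√(2 * Real.pi))⁻¹ * Real.exp (-y ^ 2 / 2))
      = (√(2 * Real.pi) * √(2 * Real.pi))⁻¹ * (Real.exp (-x ^ 2 / 2) * Real.exp (-y ^ 2 / 2)) := by
        rw [mul_inv]
        ring
    _ = _ := by
        rw [h, ← Real.exp_add]
        congr 2
        ring

theorem lintegral_exp_mul_cosh_pow (n : ℕ) {x : ℝ} (hx : 0 < x) :
    ∫⁻ s, ENNReal.ofReal (Real.exp (-x * Real.cosh s) * Real.cosh s ^ n) =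
      ENNReal.ofReal (2 * coshMoment n x) := by
  have h1 : ∫⁻ s in Ioi (0 : ℝ), ENNReal.ofReal (Real.exp (-x * Real.cosh s) * Real.cosh s ^ n) =
      ENNReal.ofReal (coshMoment n x) :=
    (ofReal_integral_eq_lintegral_ofReal (integrableOn_exp_mul_cosh_pow n hx)
      (Eventually.of_forall fun t => by simp only [Pi.zero_apply]; positivity)).symm
  have h2 : ∫⁻ s in Iic (0 : ℝ), ENNReal.ofReal (Real.exp (-x * Real.cosh s) * Real.cosh s ^ n) =
      ENNReal.ofReal (coshMoment n x) := by
    have h3 := (Measure.measurePreserving_neg (volume : Measure ℝ)).setLIntegral_comp_preimage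
      (measurableSet_Ioi (a := (0 : ℝ)))
      (f := fun s => ENNReal.ofReal (Real.exp (-x * Real.cosh s) * Real.cosh s ^ n))
      (continuous_exp_mul_cosh_pow n x).measurable.ennreal_ofReal
    rw [← setLIntegral_congr Iio_ae_eq_Iic, ← h1, ← h3]
    simp
  rw [← lintegral_add_compl _ (measurableSet_Ioi (a := (0 : ℝ))), compl_Ioi, h1, h2,
    ← ENNReal.ofReal_add (coshMoment_pos n hx).le (coshMoment_pos n hx).le, two_mul]

theorem integrable_sq_of_map_eq_gaussianReal {Ω : Type*} [MeasurableSpace Ω] {P : Measure Ω}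
    {N : Ω → ℝ} (hN : Measurable N)
    (hlaw : P.map N = gaussianReal 0 1) : Integrable (fun ω => N ω ^ 2) P := by
  have h2 : MemLp id 2 (P.map N) := by
    rw [hlaw]
    exact memLp_id_gaussianReal 2
  exact (h2.comp_of_map hN.aemeasurable).integrable_sq

section Law

variable {Ω : Type*} [MeasurableSpace Ω] {P : Measure Ω} [IsProbabilityMeasure P]
  {N₁ N₂ : Ω → ℝ}

/-- Describes the joint law of product and sum of squares. Taking `ψ = 1` yields the density, and `ψ
= ENNReal.ofReal` the conditional mean. -/
theorem lintegral_mul_sq_add_sq (hN₁ : Measurable N₁) (hN₂ : Measurable N₂)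
    (hlaw₁ : P.map N₁ = gaussianReal 0 1) (hlaw₂ : P.map N₂ = gaussianReal 0 1)
    (hindep : IndepFun N₁ N₂ P) {φ ψ : ℝ → ENNReal} (hφ : Measurable φ) (hψ : Measurable ψ) :
    ∫⁻ ω, φ (N₁ ω * N₂ ω) * ψ (N₁ ω ^ 2 + N₂ ω ^ 2) ∂P =
      ∫⁻ z, φ z * ∫⁻ s, ENNReal.ofReal ((2 * Real.pi)⁻¹ * Real.exp (-|z| * Real.cosh s)) *
        ψ (2 * |z| * Real.cosh s) := by
  have hG : Measurable fun r : ℝ =>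
      ENNReal.ofReal ((2 * Real.pi)⁻¹ * Real.exp (-r / 2)) * ψ r := by fun_prop
  have hpdf := measurable_gaussianPDF 0 1
  have h := lintegral_lintegral_mul_sq_add_sq hφ hG
  have hF : Measurable fun p : ℝ × ℝ => φ (p.1 * p.2) * ψ (p.1 ^ 2 + p.2 ^ 2) := by fun_prop
  have h1 := (indepFun_iff_map_prod_eq_prod_map_map hN₁.aemeasurable hN₂.aemeasurable).1 hindep
  rw [hlaw₁, hlaw₂] at h1
  have h2 := lintegral_map (μ := P) hF (hN₁.prodMk hN₂)
  rw [h1, lintegral_prod _ hF.aemeasurable] at h2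
  rw [← h2, gaussianReal_of_var_ne_zero 0 one_ne_zero,
    lintegral_withDensity_eq_lintegral_mul _ hpdf
      (Measurable.lintegral_prod_right' (f := fun p : ℝ × ℝ => _) hF)]
  simp only [Pi.mul_apply]
  refine Eq.trans (lintegral_congr fun x => ?_) (h.trans (lintegral_congr fun z => ?_))
  · have hx : Measurable fun y : ℝ => φ (x * y) * ψ (x ^ 2 + y ^ 2) := by fun_prop
    rw [lintegral_withDensity_eq_lintegral_mul _ hpdf hx,
      ← lintegral_const_mul _ (hpdf.mul hx)]
    refine lintegral_congr fun y => ?_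
    simp only [Pi.mul_apply]
    rw [← gaussianPDF_mul_gaussianPDF]
    ring
  · congr 1
    refine lintegral_congr fun s => ?_
    congr 5
    ring

theorem map_mul_eq_withDensity (hN₁ : Measurable N₁) (hN₂ : Measurable N₂)
    (hlaw₁ : P.map N₁ = gaussianReal 0 1) (hlaw₂ : P.map N₂ = gaussianReal 0 1)
    (hindep : IndepFun N₁ N₂ P) :
    P.map (fun ω => N₁ ω * N₂ ω) =
      volume.withDensity fun x => ENNReal.ofReal (besselK 0 |x| / Real.pi) := by
  ext A hA
  have hT : Measurable fun ω => N₁ ω * N₂ ω := hN₁.mul hN₂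
  have h := lintegral_mul_sq_add_sq hN₁ hN₂ hlaw₁ hlaw₂ hindep
    (φ := A.indicator 1) (ψ := 1) (measurable_one.indicator hA) measurable_one
  simp only [Pi.one_apply, mul_one] at h
  rw [← lintegral_map (measurable_one.indicator hA) hT,
    lintegral_indicator_one hA] at h
  rw [h, withDensity_apply _ hA, ← lintegral_indicator hA]
  refine lintegral_congr_ae ?_
  filter_upwards [Measure.ae_ne volume 0] with z hz
  by_cases hzA : z ∈ A
  · simp only [hzA, indicator_of_mem, Pi.one_apply, one_mul]
    have h0 := lintegral_exp_mul_cosh_pow 0 (abs_pos.2 hz)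
    simp only [pow_zero, mul_one] at h0
    simp only [ENNReal.ofReal_mul (show 0 ≤ (2 * Real.pi)⁻¹ by positivity)]
    rw [lintegral_const_mul' _ _ ENNReal.ofReal_ne_top, h0, ← besselK_zero_eq,
      ← ENNReal.ofReal_mul (by positivity)]
    congr 1
    field_simp
  · simp [hzA]

/-- The first moment of `cosh s` under `e^{-|z| cosh s}` is `2 K₁(|z|)`, while the density carries
`K₀(|z|)`; their ratio is what `theta` records. -/
theorem lintegral_indicator_sq_add_sq (hN₁ : Measurable N₁) (hN₂ : Measurable N₂)
    (hlaw₁ : P.map N₁ = gaussianReal 0 1) (hlaw₂ : P.map N₂ = gaussianReal 0 1)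
    (hindep : IndepFun N₁ N₂ P) {A : Set ℝ} (hA : MeasurableSet A) :
    ∫⁻ ω in (fun ω => N₁ ω * N₂ ω) ⁻¹' A, ENNReal.ofReal (N₁ ω ^ 2 + N₂ ω ^ 2) ∂P =
      ∫⁻ ω in (fun ω => N₁ ω * N₂ ω) ⁻¹' A, ENNReal.ofReal (theta (N₁ ω * N₂ ω)) ∂P := by
  have hT : Measurable fun ω => N₁ ω * N₂ ω := hN₁.mul hN₂
  have hθ : Measurable fun x => ENNReal.ofReal (theta x) := measurable_theta.ennreal_ofReal
  have h := lintegral_mul_sq_add_sq hN₁ hN₂ hlaw₁ hlaw₂ hindep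
    (φ := A.indicator 1) (ψ := ENNReal.ofReal) (measurable_one.indicator hA)
    ENNReal.measurable_ofReal
  have hd : Measurable fun x => ENNReal.ofReal (besselK 0 |x| / Real.pi) := by
    have := measurable_besselK 0
    have ha : Measurable fun x : ℝ => |x| := measurable_norm
    fun_prop
  have hR : ∫⁻ ω in (fun ω => N₁ ω * N₂ ω) ⁻¹' A, ENNReal.ofReal (theta (N₁ ω * N₂ ω)) ∂P =
      ∫⁻ z in A, ENNReal.ofReal (besselK 0 |z| / Real.pi) * ENNReal.ofReal (theta z) := by
    rw [← setLIntegral_map hA hθ hT, map_mul_eq_withDensity hN₁ hN₂ hlaw₁ hlaw₂ hindep,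
      setLIntegral_withDensity_eq_setLIntegral_mul _ hd hθ hA]
    rfl
  rw [hR, ← lintegral_indicator hA, ← lintegral_indicator (hT hA)]
  refine Eq.trans (lintegral_congr fun ω => ?_) (h.trans (lintegral_congr_ae ?_))
  · by_cases hω : N₁ ω * N₂ ω ∈ A <;> simp [indicator, hω]
  · filter_upwards [Measure.ae_ne volume 0] with z hz
    by_cases hzA : z ∈ A
    · have hz' := abs_pos.2 hz
      simp only [hzA, indicator_of_mem, Pi.one_apply, one_mul]
      have h1 := lintegral_exp_mul_cosh_pow 1 hz'
      have h2 : ∀ s : ℝ, ENNReal.ofReal ((2 * Real.pi)⁻¹ * Real.exp (-|z| * Real.cosh s)) *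
          ENNReal.ofReal (2 * |z| * Real.cosh s) = ENNReal.ofReal (|z| / Real.pi) *
          ENNReal.ofReal (Real.exp (-|z| * Real.cosh s) * Real.cosh s ^ 1) := fun s => by
        rw [← ENNReal.ofReal_mul (by positivity), ← ENNReal.ofReal_mul (by positivity)]
        congr 1
        field_simp
      simp only [h2]
      have hK := besselK_zero_pos hz'
      rw [lintegral_const_mul' _ _ ENNReal.ofReal_ne_top, h1, ← besselK_one_eq,
        ← ENNReal.ofReal_mul (by positivity), ← ENNReal.ofReal_mul (by positivity)]
      congr 1
      unfold theta
      field_simp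
    · simp [hzA]

theorem theta_nonneg (x : ℝ) : 0 ≤ theta x := by
  rcases eq_or_ne x 0 with rfl | hx
  · simp [theta]
  · have h0 := besselK_zero_pos (abs_pos.2 hx)
    have h1 := besselK_one_pos (abs_pos.2 hx)
    unfold theta
    positivity

theorem integrable_theta_mul (hN₁ : Measurable N₁) (hN₂ : Measurable N₂)
    (hlaw₁ : P.map N₁ = gaussianReal 0 1) (hlaw₂ : P.map N₂ = gaussianReal 0 1)
    (hindep : IndepFun N₁ N₂ P) :
    Integrable (fun ω => theta (N₁ ω * N₂ ω)) P := by
  have hf : Integrable (fun ω => N₁ ω ^ 2 + N₂ ω ^ 2) P :=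
    (integrable_sq_of_map_eq_gaussianReal hN₁ hlaw₁).add
      (integrable_sq_of_map_eq_gaussianReal hN₂ hlaw₂)
  refine ⟨(measurable_theta.comp (hN₁.mul hN₂)).aestronglyMeasurable, ?_⟩
  rw [hasFiniteIntegral_iff_ofReal (Eventually.of_forall fun ω => theta_nonneg _)]
  have h := lintegral_indicator_sq_add_sq hN₁ hN₂ hlaw₁ hlaw₂ hindep MeasurableSet.univ
  simp only [preimage_univ, Measure.restrict_univ] at h
  rw [← h, ← hasFiniteIntegral_iff_ofReal (Eventually.of_forall fun ω => by positivity)]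
  exact hf.2

theorem condExp_sq_add_sq (hN₁ : Measurable N₁) (hN₂ : Measurable N₂)
    (hlaw₁ : P.map N₁ = gaussianReal 0 1) (hlaw₂ : P.map N₂ = gaussianReal 0 1)
    (hindep : IndepFun N₁ N₂ P) :
    P[fun ω => N₁ ω ^ 2 + N₂ ω ^ 2 |
        MeasurableSpace.comap (fun ω => N₁ ω * N₂ ω) inferInstance]
      =ᵐ[P] fun ω => theta (N₁ ω * N₂ ω) := by
  have hT : Measurable fun ω => N₁ ω * N₂ ω := hN₁.mul hN₂
  have hθ : Measurable fun ω => theta (N₁ ω * N₂ ω) := measurable_theta.comp hT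
  have hf : Integrable (fun ω => N₁ ω ^ 2 + N₂ ω ^ 2) P :=
    (integrable_sq_of_map_eq_gaussianReal hN₁ hlaw₁).add
      (integrable_sq_of_map_eq_gaussianReal hN₂ hlaw₂)
  have hgi := integrable_theta_mul hN₁ hN₂ hlaw₁ hlaw₂ hindep
  refine (ae_eq_condExp_of_forall_setIntegral_eq hT.comap_le hf (fun s _ _ => hgi.integrableOn)
    ?_ ?_).symm
  · rintro s ⟨A, hA, rfl⟩ -
    rw [integral_eq_lintegral_of_nonneg_ae (Eventually.of_forall fun ω => theta_nonneg _)
        hθ.aestronglyMeasurable,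
      integral_eq_lintegral_of_nonneg_ae
        (Eventually.of_forall fun ω => by simp only [Pi.zero_apply]; positivity)
        hf.aestronglyMeasurable.restrict,
      lintegral_indicator_sq_add_sq hN₁ hN₂ hlaw₁ hlaw₂ hindep hA]
  · exact (measurable_theta.comp (comap_measurable _)).aestronglyMeasurable

end Law

/-! ### Control at infinity -/

/-- Integrate `(u u' w)' = u'² w + u u'' w + u u' w'`. Young's inequality bounds the right side
below by `½ u'² w - m` with `m` integrable, so only the boundary term `u u' w` at `R` could
obstruct. It is applied with `w = K₀`, `u = f` and with `w = 1/K₀`, `u = g K₀`. -/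
theorem integrableOn_deriv_sq_mul_weight {u u₁ u₂ w w₁ : ℝ → ℝ} {C : ℝ}
    (hu : ∀ x ∈ Ici (1 : ℝ), HasDerivAt u (u₁ x) x)
    (hu₁ : ∀ x ∈ Ici (1 : ℝ), HasDerivAt u₁ (u₂ x) x)
    (hw : ∀ x ∈ Ici (1 : ℝ), HasDerivAt w (w₁ x) x)
    (hu₂ : ContinuousOn u₂ (Ici 1)) (hw₁ : ContinuousOn w₁ (Ici 1))
    (hpos : ∀ x ∈ Ici (1 : ℝ), 0 < w x) (hC : ∀ x ∈ Ici (1 : ℝ), |w₁ x| ≤ C * w x)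
    (hi : IntegrableOn (fun x => u x ^ 2 * w x) (Ioi 1))
    (hF : IntegrableOn (fun x => (u₂ x + u₁ x / x) ^ 2 * w x) (Ioi 1)) :
    IntegrableOn (fun x => u₁ x ^ 2 * w x) (Ioi 1) := by
  have cu : ContinuousOn u (Ici 1) := fun x hx => (hu x hx).continuousAt.continuousWithinAt
  have cu₁ : ContinuousOn u₁ (Ici 1) := fun x hx => (hu₁ x hx).continuousAt.continuousWithinAt
  have cw : ContinuousOn w (Ici 1) := fun x hx => (hw x hx).continuousAt.continuousWithinAt
  have hint : ∀ {h : ℝ → ℝ}, ContinuousOn h (Ici 1) → ∀ {a b : ℝ}, 1 ≤ a → a ≤ b →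
      IntervalIntegrable h volume a b := fun hh a b ha hab =>
    (hh.mono fun x hx => by rw [uIcc_of_le hab] at hx; exact ha.trans hx.1).intervalIntegrable
  have hC0 : 0 ≤ C := by
    have h1 := hC 1 self_mem_Ici
    have h2 := hpos 1 self_mem_Ici
    exact nonneg_of_mul_nonneg_left ((abs_nonneg _).trans h1) h2
  -- In the coefficient of `u² w`, `C²` pays for `u u' w'`, `1` for `u u'/x`, and `1/2` for `u (u''
  -- + u'/x)`. The first two terms cost `1/4` of `u'² w` each.
  set m : ℝ → ℝ := fun x => (3 / 2 + C ^ 2) * (u x ^ 2 * w x) +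
    1 / 2 * ((u₂ x + u₁ x / x) ^ 2 * w x) with hm
  have mi : IntegrableOn m (Ioi 1) := (hi.const_mul _).add (hF.const_mul _)
  have m0 : ∀ x ∈ Ioi (1 : ℝ), 0 ≤ m x := fun x hx => by
    have := hpos x (mem_Ici_of_Ioi hx)
    positivity
  have tail : ∀ {h : ℝ → ℝ}, IntegrableOn h (Ioi 1) → (∀ x ∈ Ioi (1 : ℝ), 0 ≤ h x) →
      ∀ {a b : ℝ}, 1 ≤ a → a ≤ b → ∫ x in a..b, h x ≤ ∫ x in Ioi (1 : ℝ), h x :=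
    fun hh h0 a b ha hab => by
      rw [intervalIntegral.integral_of_le hab]
      exact setIntegral_mono_set hh (by filter_upwards [ae_restrict_mem measurableSet_Ioi] using h0)
        (Eventually.of_forall fun x hx => lt_of_le_of_lt ha hx.1)
  have cd : ContinuousOn
      (fun x => (u₁ x * u₁ x + u x * u₂ x) * w x + u x * u₁ x * w₁ x) (Ici 1) := by fun_prop
  have cm : ContinuousOn m (Ici 1) := by
    have : ContinuousOn (fun x => u₁ x / x) (Ici 1) := cu₁.div continuousOn_id fun x hx =>
      (zero_lt_one.trans_le hx).ne'
    fun_prop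
  have cA : ContinuousOn (fun x => u₁ x ^ 2 * w x) (Ici 1) := by fun_prop
  have lower : ∀ x ∈ Ici (1 : ℝ), 1 / 2 * (u₁ x ^ 2 * w x) - m x ≤
      (u₁ x * u₁ x + u x * u₂ x) * w x + u x * u₁ x * w₁ x := fun x hx => by
    have hx1 : 1 ≤ x := hx
    have hx0 : 0 < x := zero_lt_one.trans_le hx1
    have hwx := hpos x hx
    have e1 : -(1 / 4 * u₁ x ^ 2 + C ^ 2 * u x ^ 2) * w x ≤ u x * u₁ x * w₁ x := by
      have h1 : |u x * u₁ x * w₁ x| ≤ |u x * u₁ x| * (C * w x) := by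
        rw [abs_mul]
        exact mul_le_mul_of_nonneg_left (hC x hx) (abs_nonneg _)
      have h2 : C * |u x * u₁ x| ≤ 1 / 4 * u₁ x ^ 2 + C ^ 2 * u x ^ 2 := by
        rw [abs_mul, ← sq_abs (u x), ← sq_abs (u₁ x)]
        nlinarith [sq_nonneg (1 / 2 * |u₁ x| - C * |u x|)]
      have h3 := neg_abs_le (u x * u₁ x * w₁ x)
      nlinarith [mul_le_mul_of_nonneg_right h2 hwx.le]
    have e2 : -(1 / 4 * u₁ x ^ 2 + u x ^ 2) ≤ -(u x * (u₁ x / x)) := by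
      have h1 : |u x * (u₁ x / x)| ≤ |u x| * |u₁ x| := by
        rw [abs_mul, abs_div, abs_of_pos hx0]
        exact mul_le_mul_of_nonneg_left (div_le_self (abs_nonneg _) hx1) (abs_nonneg _)
      have h2 : |u x| * |u₁ x| ≤ 1 / 4 * u₁ x ^ 2 + u x ^ 2 := by
        rw [← sq_abs (u x), ← sq_abs (u₁ x)]
        nlinarith [sq_nonneg (1 / 2 * |u₁ x| - |u x|)]
      linarith [le_abs_self (u x * (u₁ x / x))]
    have e3 : -(1 / 2 * u x ^ 2 + 1 / 2 * (u₂ x + u₁ x / x) ^ 2) ≤ u x * (u₂ x + u₁ x / x) := by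
      nlinarith [sq_nonneg (u x + (u₂ x + u₁ x / x))]
    have e4 : -(3 / 2 * u x ^ 2 + 1 / 4 * u₁ x ^ 2 + 1 / 2 * (u₂ x + u₁ x / x) ^ 2) * w x ≤
        u x * u₂ x * w x := by
      refine mul_le_mul_of_nonneg_right ?_ hwx.le
      linarith
    simp only [hm]
    linarith
  have FTC : ∀ {R : ℝ}, 1 ≤ R → 1 / 2 * (∫ x in (1 : ℝ)..R, u₁ x ^ 2 * w x) -
      ∫ x in Ioi (1 : ℝ), m x ≤ u R * u₁ R * w R - u 1 * u₁ 1 * w 1 := fun {R} hR => by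
    rw [← intervalIntegral.integral_eq_sub_of_hasDerivAt (f := fun x => u x * u₁ x * w x)
      (fun x hx => ?_) (hint cd le_rfl hR)]
    · have h1 := tail mi m0 le_rfl hR
      have h2 : (∫ x in (1 : ℝ)..R, 1 / 2 * (u₁ x ^ 2 * w x) - m x) ≤
          ∫ x in (1 : ℝ)..R, (u₁ x * u₁ x + u x * u₂ x) * w x + u x * u₁ x * w₁ x :=
        intervalIntegral.integral_mono_on hR (hint (by fun_prop) le_rfl hR) (hint cd le_rfl hR)
          fun x hx => lower x hx.1
      rw [intervalIntegral.integral_sub ((hint cA le_rfl hR).const_mul _) (hint cm le_rfl hR),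
        intervalIntegral.integral_const_mul] at h2
      linarith
    · rw [uIcc_of_le hR] at hx
      exact ((hu x hx.1).mul (hu₁ x hx.1)).mul (hw x hx.1)
  -- A bounded boundary term along some sequence `R → ∞` suffices, as the integrals increase with
  -- `R`. Otherwise `u u' w > 1` eventually, so `(u² w)' ≥ 2 - C u² w` and `u² w` grows at least
  -- linearly, contradicting its integrability.
  by_cases hfreq : ∃ᶠ R in atTop, u R * u₁ R * w R ≤ 1
  · refine integrableOn_Ioi_of_intervalIntegral_norm_bounded (l := atTop) (b := id)
      (2 * (1 - u 1 * u₁ 1 * w 1 + ∫ x in Ioi (1 : ℝ), m x)) 1 (fun R => ?_) tendsto_id ?_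
    · rcases le_total 1 R with hR | hR
      · exact (intervalIntegrable_iff_integrableOn_Ioc_of_le hR).1 (hint cA le_rfl hR)
      · simp [Ioc_eq_empty_of_le hR]
    · filter_upwards [eventually_ge_atTop 1] with R hR
      obtain ⟨S, hS, hRS⟩ := (hfreq.and_eventually (eventually_ge_atTop R)).exists
      have h1 := FTC (hR.trans hRS)
      have h2 : (∫ x in (1 : ℝ)..R, ‖u₁ x ^ 2 * w x‖) = ∫ x in (1 : ℝ)..R, u₁ x ^ 2 * w x :=
        intervalIntegral.integral_congr fun x hx => by
          rw [uIcc_of_le hR] at hx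
          have := hpos x hx.1
          exact Real.norm_of_nonneg (by positivity)
      have h3 : (∫ x in (1 : ℝ)..R, u₁ x ^ 2 * w x) ≤ ∫ x in (1 : ℝ)..S, u₁ x ^ 2 * w x := by
        refine intervalIntegral.integral_mono_interval le_rfl hR hRS ?_
          (hint cA le_rfl (hR.trans hRS))
        filter_upwards [ae_restrict_mem measurableSet_Ioc] with x hx
        have := hpos x hx.1.le
        simp only [Pi.zero_apply]
        positivity
      simp only [id]
      rw [h2]
      linarith
  · exfalso
    rw [not_frequently] at hfreq
    obtain ⟨R₀, hR₀⟩ := eventually_atTop.1 (hfreq.and (eventually_ge_atTop 1))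
    have h0 : 1 ≤ R₀ := (hR₀ R₀ le_rfl).2
    have i0 : ∀ x ∈ Ioi (1 : ℝ), 0 ≤ u x ^ 2 * w x := fun x hx => by
      have := hpos x (mem_Ici_of_Ioi hx)
      positivity
    have grow : ∀ R, R₀ ≤ R → 2 * (R - R₀) - C * ∫ x in Ioi (1 : ℝ), u x ^ 2 * w x ≤
        u R ^ 2 * w R := fun R hR => by
      have cE : ContinuousOn (fun x => 2 * (u x * u₁ x) * w x + u x ^ 2 * w₁ x) (Ici 1) := by
        fun_prop
      have ci : ContinuousOn (fun x => u x ^ 2 * w x) (Ici 1) := by fun_prop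
      have h1 := intervalIntegral.integral_eq_sub_of_hasDerivAt (f := fun x => u x ^ 2 * w x)
        (f' := fun x => 2 * (u x * u₁ x) * w x + u x ^ 2 * w₁ x) (a := R₀) (b := R)
        (fun x hx => by
          rw [uIcc_of_le hR] at hx
          have hx1 : x ∈ Ici (1 : ℝ) := h0.trans hx.1
          convert! ((hu x hx1).pow 2).mul (hw x hx1) using 1
          simp
          left
          ring) (hint cE h0 hR)
      have h2 : (∫ x in R₀..R, 2 - C * (u x ^ 2 * w x)) ≤
          ∫ x in R₀..R, 2 * (u x * u₁ x) * w x + u x ^ 2 * w₁ x := by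
        refine intervalIntegral.integral_mono_on hR (hint (by fun_prop) h0 hR) (hint cE h0 hR)
          fun x hx => ?_
        have hx1 := not_le.1 (hR₀ x hx.1).1
        have h3 := (abs_le.1 (hC x (h0.trans hx.1))).1
        nlinarith [mul_le_mul_of_nonneg_left h3 (sq_nonneg (u x))]
      rw [intervalIntegral.integral_sub (by simp) ((hint ci h0 hR).const_mul _),
        intervalIntegral.integral_const_mul, intervalIntegral.integral_const, smul_eq_mul] at h2
      have h4 := mul_le_mul_of_nonneg_left (tail hi i0 h0 hR) hC0
      have h5 : 0 ≤ u R₀ ^ 2 * w R₀ := by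
        have := hpos R₀ h0
        positivity
      linarith
    -- Chosen so that the lower bound in `grow` is at least `1` from `R₁` on.
    set R₁ := R₀ + (1 + C * ∫ x in Ioi (1 : ℝ), u x ^ 2 * w x) / 2 with hR₁
    have hI : IntegrableOn (fun _ : ℝ => (1 : ℝ)) (Ioi (max R₀ R₁)) := by
      refine Integrable.mono' (hi.mono_set (Ioi_subset_Ioi (h0.trans (le_max_left R₀ R₁))))
        aestronglyMeasurable_const ?_
      filter_upwards [ae_restrict_mem measurableSet_Ioi] with x hx
      have h1 := grow x ((le_max_left _ _).trans (le_of_lt hx))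
      have h2 : R₁ ≤ x := (le_max_right _ _).trans (le_of_lt hx)
      rw [norm_one]
      linarith
    rw [integrableOn_const_iff] at hI
    simp at hI

/-- A nonzero limit would make `W x / x` comparable to `1/x`, which is not integrable at infinity.
-/
theorem eq_zero_of_tendsto_of_integrableOn_div {W : ℝ → ℝ} {c : ℝ} (h : Tendsto W atTop (𝓝 c))
    (hi : IntegrableOn (fun x => W x / x) (Ioi 1)) : c = 0 := by
  by_contra hc
  have hc' : 0 < |c| := abs_pos.2 hc
  obtain ⟨R, hR⟩ := eventually_atTop.1 ((h.abs.eventually (lt_mem_nhds (half_lt_self hc'))).and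
    (eventually_ge_atTop 1))
  refine not_integrableOn_Ioi_inv (a := R) ?_
  have h1 : 1 ≤ R := (hR R le_rfl).2
  refine Integrable.mono' (((hi.mono_set (Ioi_subset_Ioi h1)).norm).const_mul (2 / |c|))
    measurable_inv.aestronglyMeasurable ?_
  filter_upwards [ae_restrict_mem measurableSet_Ioi] with x hx
  obtain ⟨hx1, hx2⟩ := hR x (le_of_lt hx)
  have hx0 : 0 < x := by linarith
  rw [norm_inv, norm_div, Real.norm_eq_abs, Real.norm_eq_abs, abs_of_pos hx0, ← mul_div_assoc,
    inv_eq_one_div]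
  gcongr
  rw [div_mul_eq_mul_div, le_div_iff₀ hc']
  linarith

/-! ### Green's formula on a half-line -/

theorem hasDerivAt_of_contDiff_two {f : ℝ → ℝ} (hf : ContDiff ℝ 2 f) :
    (∀ x, HasDerivAt f (deriv f x) x) ∧ (∀ x, HasDerivAt (deriv f) (deriv (deriv f) x) x) ∧
      Continuous f ∧ Continuous (deriv f) ∧ Continuous (deriv (deriv f)) := by
  have h1 : ContDiff ℝ 1 (deriv f) := (contDiff_succ_iff_deriv.1 hf).2.2
  exact ⟨fun x => (hf.differentiable (by norm_num) x).hasDerivAt,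
    fun x => (h1.differentiable (by norm_num) x).hasDerivAt, hf.continuous, h1.continuous,
    h1.continuous_deriv le_rfl⟩

theorem continuous_steinR {f : ℝ → ℝ} (hf : ContDiff ℝ 2 f) : Continuous (steinR f) := by
  obtain ⟨-, -, c0, c1, c2⟩ := hasDerivAt_of_contDiff_two hf
  unfold steinR
  fun_prop

/-- The boundary form `x (f (g K₀)' - f' g K₀)`. -/
noncomputable def boundaryForm (f g : ℝ → ℝ) (x : ℝ) : ℝ :=
  x * (f x * (deriv g x * besselK 0 x - g x * besselK 1 x) - deriv f x * (g x * besselK 0 x))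

/-- The difference of the two sides of Green's formula, as an integrand on `(0, ∞)`. -/
noncomputable def greenIntegrand (f g : ℝ → ℝ) (x : ℝ) : ℝ :=
  (steinR f x * g x - f x * steinRAdj g x) * besselK 0 |x|

theorem theta_of_pos {x : ℝ} (hx : 0 < x) : theta x = 2 * x * (besselK 1 x / besselK 0 x) := by
  rw [theta, abs_of_pos hx]

theorem hasDerivAt_mul_besselK_zero {g : ℝ → ℝ} (hg : ContDiff ℝ 2 g) {x : ℝ} (hx : 0 < x) :
    HasDerivAt (fun y => g y * besselK 0 y) (deriv g x * besselK 0 x - g x * besselK 1 x) x := by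
  convert! ((hasDerivAt_of_contDiff_two hg).1 x).mul (hasDerivAt_besselK_zero hx) using 1
  ring

theorem hasDerivAt_deriv_mul_besselK_zero {g : ℝ → ℝ} (hg : ContDiff ℝ 2 g) {x : ℝ} (hx : 0 < x) :
    HasDerivAt (fun y => deriv g y * besselK 0 y - g y * besselK 1 y)
      (deriv (deriv g) x * besselK 0 x - 2 * deriv g x * besselK 1 x +
        g x * (besselK 0 x + besselK 1 x / x)) x := by
  obtain ⟨h0, h1, -⟩ := hasDerivAt_of_contDiff_two hg
  convert! ((h1 x).mul (hasDerivAt_besselK_zero hx)).sub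
    ((h0 x).mul (hasDerivAt_besselK_one hx)) using 1
  ring

theorem hasDerivAt_boundaryForm {f g : ℝ → ℝ} (hf : ContDiff ℝ 2 f) (hg : ContDiff ℝ 2 g) {x : ℝ}
    (hx : 0 < x) : HasDerivAt (boundaryForm f g) (greenIntegrand f g x) x := by
  obtain ⟨f0, f1, -⟩ := hasDerivAt_of_contDiff_two hf
  convert! (hasDerivAt_id x).mul (((f0 x).mul (hasDerivAt_deriv_mul_besselK_zero hg hx)).sub
    ((f1 x).mul (hasDerivAt_mul_besselK_zero hg hx))) using 1
  have hK := (besselK_zero_pos hx).ne'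
  simp only [greenIntegrand, steinRAdj, steinR, theta_of_pos hx, abs_of_pos hx, id]
  simp only [Pi.sub_apply, Pi.mul_apply]
  field_simp
  ring

theorem tendsto_boundaryForm_zero {f g : ℝ → ℝ} (hf : ContDiff ℝ 2 f) (hg : ContDiff ℝ 2 g) :
    Tendsto (boundaryForm f g) (𝓝[>] 0) (𝓝 (-(f 0 * g 0))) := by
  obtain ⟨-, -, f0, f1, -⟩ := hasDerivAt_of_contDiff_two hf
  obtain ⟨-, -, g0, g1, -⟩ := hasDerivAt_of_contDiff_two hg
  have L : ∀ {h : ℝ → ℝ}, Continuous h → Tendsto h (𝓝[>] 0) (𝓝 (h 0)) := fun hh =>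
    (hh.tendsto 0).mono_left nhdsWithin_le_nhds
  have h := (((L f0).mul (L g1)).mul tendsto_mul_besselK_zero).sub
    (((L f0).mul (L g0)).mul tendsto_mul_besselK_one) |>.sub
    (((L f1).mul (L g0)).mul tendsto_mul_besselK_zero)
  simp only [mul_zero, mul_one, sub_zero, zero_sub] at h
  refine h.congr fun x => ?_
  unfold boundaryForm
  ring

theorem integral_greenIntegrand_Ioi {f g : ℝ → ℝ} (hf : ContDiff ℝ 2 f) (hg : ContDiff ℝ 2 g)
    (hi : IntegrableOn (greenIntegrand f g) (Ioi 0))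
    (hlim : Tendsto (boundaryForm f g) atTop (𝓝 0)) :
    ∫ x in Ioi 0, greenIntegrand f g x = f 0 * g 0 := by
  have hne : ∀ x : ℝ, 0 < x →
      Function.update (boundaryForm f g) 0 (-(f 0 * g 0)) =ᶠ[𝓝 x] boundaryForm f g := fun x hx => by
    filter_upwards [eventually_ne_nhds hx.ne'] with y hy using Function.update_of_ne hy _ _
  -- The factor `x` makes `boundaryForm` equal `0` at `0`, which need not be its right limit; the
  -- update restores right continuity there.
  rw [integral_Ioi_of_hasDerivAt_of_tendsto
    (f := Function.update (boundaryForm f g) 0 (-(f 0 * g 0))) (m := 0) ?_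
    (fun x hx => (hasDerivAt_boundaryForm hf hg hx).congr_of_eventuallyEq (hne x hx)) hi
    (hlim.congr' ?_)]
  · simp
  · rw [continuousWithinAt_update_same, Ici_sdiff_left]
    exact tendsto_boundaryForm_zero hf hg
  · filter_upwards [eventually_gt_atTop 0] with x hx using (Function.update_of_ne hx.ne' _ _).symm

/-- The limit exists since the derivative is integrable. It vanishes because `W/x = f (g K₀)' - f' g
K₀` is integrable, by pairing `L²(K₀)` with `L²(1/K₀)`. -/
theorem tendsto_boundaryForm_atTop {f g : ℝ → ℝ} (hf : ContDiff ℝ 2 f) (hg : ContDiff ℝ 2 g)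
    (hi : IntegrableOn (greenIntegrand f g) (Ioi 1))
    (if0 : IntegrableOn (fun x => f x ^ 2 * besselK 0 x) (Ioi 1))
    (if1 : IntegrableOn (fun x => steinR f x ^ 2 * besselK 0 x) (Ioi 1))
    (ig0 : IntegrableOn (fun x => g x ^ 2 * besselK 0 x) (Ioi 1))
    (ig1 : IntegrableOn (fun x => steinRAdj g x ^ 2 * besselK 0 x) (Ioi 1)) :
    Tendsto (boundaryForm f g) atTop (𝓝 0) := by
  obtain ⟨df0, df1, cf0, cf1, cf2⟩ := hasDerivAt_of_contDiff_two hf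
  obtain ⟨dg0, dg1, cg0, cg1, cg2⟩ := hasDerivAt_of_contDiff_two hg
  have pos : ∀ x ∈ Ici (1 : ℝ), 0 < x := fun x hx => zero_lt_one.trans_le hx
  have Kpos : ∀ x ∈ Ici (1 : ℝ), 0 < besselK 0 x := fun x hx => besselK_zero_pos (pos x hx)
  have sub : Ici (1 : ℝ) ⊆ Ioi 0 := pos
  have cK0 := continuousOn_besselK_zero.mono sub
  have cK1 := continuousOn_besselK_one.mono sub
  have cinv : ContinuousOn (fun x : ℝ => x⁻¹) (Ici 1) := continuousOn_id.inv₀ fun x hx =>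
    (pos x hx).ne'
  have cKinv : ContinuousOn (fun x : ℝ => (besselK 0 x)⁻¹) (Ici 1) := cK0.inv₀ fun x hx =>
    (Kpos x hx).ne'
  have meas : ∀ {h : ℝ → ℝ}, ContinuousOn h (Ici 1) →
      AEStronglyMeasurable h (volume.restrict (Ioi 1)) := fun hh =>
    (hh.mono Ioi_subset_Ici_self).aestronglyMeasurable measurableSet_Ioi
  have mono : ∀ {h k : ℝ → ℝ}, ContinuousOn h (Ici 1) → IntegrableOn k (Ioi 1) →
      (∀ x ∈ Ici (1 : ℝ), |h x| ≤ k x) → IntegrableOn h (Ioi 1) := fun hh hk hle => by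
    refine Integrable.mono' hk (meas hh) ?_
    filter_upwards [ae_restrict_mem measurableSet_Ioi] with x hx using hle x (mem_Ici_of_Ioi hx)
  have sq_bound : ∀ {a b x k : ℝ}, 1 ≤ x → 0 ≤ k →
      |(a - b / x) ^ 2 * k| ≤ 2 * (a ^ 2 * k) + 2 * (b ^ 2 * k) := fun {a b x k} hx hk => by
    rw [abs_of_nonneg (by positivity)]
    have h1 : (b / x) ^ 2 ≤ b ^ 2 := by
      rw [div_pow]
      exact div_le_self (sq_nonneg b) (one_le_pow₀ hx)
    nlinarith [sq_nonneg (a + b / x)]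
  set C := besselK 1 1 / besselK 0 1
  have hC : ∀ x ∈ Ici (1 : ℝ), besselK 1 x ≤ C * besselK 0 x := fun x hx =>
    besselK_one_le_mul_besselK_zero hx
  have jf : IntegrableOn (fun x => deriv f x ^ 2 * besselK 0 x) (Ioi 1) := by
    refine integrableOn_deriv_sq_mul_weight (u := f) (C := C) (fun x _ => df0 x) (fun x _ => df1 x)
      (fun x hx => hasDerivAt_besselK_zero (pos x hx)) cf2.continuousOn cK1.neg Kpos
      (fun x hx => ?_) if0 ?_
    · rw [abs_neg, abs_of_pos (besselK_one_pos (pos x hx))]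
      exact hC x hx
    · refine mono ?_ ((if0.const_mul 2).add (if1.const_mul 2)) fun x hx => ?_
      · simp only [div_eq_mul_inv]
        fun_prop
      · have hx0 := (pos x hx).ne'
        have e : deriv (deriv f) x + deriv f x / x = f x - steinR f x / x := by
          unfold steinR
          field_simp
          ring
        rw [e]
        exact sq_bound hx (Kpos x hx).le
  -- For `v = g K₀` one has `v'' + v'/x = (g - R⋆g / x) K₀`, the same shape as `f'' + f'/x = f - R f
  -- / x`; the dual weight `1/K₀` turns its square into `(g - R⋆g / x)² K₀`.
  have jg : IntegrableOn (fun x => (deriv g x * besselK 0 x - g x * besselK 1 x) ^ 2 *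
      (besselK 0 x)⁻¹) (Ioi 1) := by
    refine integrableOn_deriv_sq_mul_weight (u := fun x => g x * besselK 0 x) (C := C)
      (fun x hx => hasDerivAt_mul_besselK_zero hg (pos x hx))
      (fun x hx => hasDerivAt_deriv_mul_besselK_zero hg (pos x hx))
      (fun x hx => (hasDerivAt_besselK_zero (pos x hx)).inv (Kpos x hx).ne') ?_ ?_
      (fun x hx => inv_pos.2 (Kpos x hx)) (fun x hx => ?_) ?_ ?_
    · simp only [div_eq_mul_inv]
      fun_prop
    · simp only [div_eq_mul_inv, neg_neg, ← inv_pow]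
      fun_prop
    · have hk := Kpos x hx
      have hk1 := besselK_one_pos (pos x hx)
      rw [neg_neg, abs_of_pos (by positivity), ← div_eq_mul_inv, div_le_div_iff₀ (by positivity) hk]
      nlinarith [hC x hx]
    · refine ig0.congr_fun (fun x hx => ?_) measurableSet_Ioi
      have hk := (Kpos x (mem_Ici_of_Ioi hx)).ne'
      simp only
      field_simp
    · refine mono ?_ ((ig0.const_mul 2).add (ig1.const_mul 2)) fun x hx => ?_
      · simp only [div_eq_mul_inv]
        fun_prop
      · have hx0 := (pos x hx).ne'
        have hk := (Kpos x hx).ne'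
        have e : (deriv (deriv g) x * besselK 0 x - 2 * deriv g x * besselK 1 x +
            g x * (besselK 0 x + besselK 1 x / x) +
            (deriv g x * besselK 0 x - g x * besselK 1 x) / x) ^ 2 * (besselK 0 x)⁻¹ =
            (g x - steinRAdj g x / x) ^ 2 * besselK 0 x := by
          unfold steinRAdj steinR
          rw [theta_of_pos (pos x hx)]
          field_simp
          ring
        rw [e]
        exact sq_bound hx (Kpos x hx).le
  have hW := tendsto_limUnder_of_hasDerivAt_of_integrableOn_Ioi
    (fun x hx => hasDerivAt_boundaryForm hf hg (zero_lt_one.trans hx)) hi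
  have hdiv : IntegrableOn (fun x => boundaryForm f g x / x) (Ioi 1) := by
    refine mono ?_ (((if0.add jg).add (jf.add ig0)).const_mul (1 / 2)) fun x hx => ?_
    · unfold boundaryForm
      simp only [div_eq_mul_inv]
      fun_prop
    · have hx0 := (pos x hx).ne'
      have hk := Kpos x hx
      set v := deriv g x * besselK 0 x - g x * besselK 1 x with hv
      have e : boundaryForm f g x / x = f x * v - deriv f x * (g x * besselK 0 x) := by
        rw [boundaryForm, mul_div_cancel_left₀ _ hx0]
      have e1 : |f x * v| ≤ 1 / 2 * (f x ^ 2 * besselK 0 x + v ^ 2 * (besselK 0 x)⁻¹) := by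
        have h1 : f x ^ 2 * besselK 0 x + v ^ 2 * (besselK 0 x)⁻¹ =
            (f x ^ 2 * besselK 0 x ^ 2 + v ^ 2) / besselK 0 x := by field_simp
        rw [h1, ← mul_div_assoc, le_div_iff₀ hk, abs_mul]
        nlinarith [sq_nonneg (|f x| * besselK 0 x - |v|), sq_abs (f x), sq_abs v]
      have e2 : |deriv f x * (g x * besselK 0 x)| ≤
          1 / 2 * (deriv f x ^ 2 * besselK 0 x + g x ^ 2 * besselK 0 x) := by
        rw [← mul_assoc, abs_mul, abs_of_pos hk, ← add_mul, ← mul_assoc, abs_mul]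
        refine mul_le_mul_of_nonneg_right ?_ hk.le
        nlinarith [sq_nonneg (|deriv f x| - |g x|), sq_abs (deriv f x), sq_abs (g x)]
      rw [e]
      refine (abs_sub _ _).trans ?_
      simp only [Pi.add_apply]
      linarith
  rwa [eq_zero_of_tendsto_of_integrableOn_div hW hdiv] at hW

/-! ### Reflection and Green's formula on the line -/

theorem deriv_comp_neg_fun (f : ℝ → ℝ) : (deriv fun x => f (-x)) = fun x => -deriv f (-x) :=
  funext fun x => deriv_comp_neg f x

theorem deriv_deriv_comp_neg (f : ℝ → ℝ) (x : ℝ) :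
    deriv (deriv fun x => f (-x)) x = deriv (deriv f) (-x) := by
  rw [deriv_comp_neg_fun, deriv.fun_neg, deriv_comp_neg, neg_neg]

theorem steinR_comp_neg (f : ℝ → ℝ) (x : ℝ) :
    steinR (fun x => f (-x)) x = -steinR f (-x) := by
  rw [steinR, deriv_deriv_comp_neg, deriv_comp_neg_fun, steinR]
  ring

theorem steinRAdj_comp_neg (f : ℝ → ℝ) (x : ℝ) :
    steinRAdj (fun x => f (-x)) x = -steinRAdj f (-x) := by
  rw [steinRAdj, steinR_comp_neg, deriv_comp_neg_fun, steinRAdj]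
  simp only [theta, abs_neg]
  ring

theorem greenIntegrand_comp_neg (f g : ℝ → ℝ) (x : ℝ) :
    greenIntegrand (fun x => f (-x)) (fun x => g (-x)) x = -greenIntegrand f g (-x) := by
  rw [greenIntegrand, steinR_comp_neg, steinRAdj_comp_neg, greenIntegrand, abs_neg]
  ring

/-- Both differential expressions anticommute with reflection, so the half-lines contribute `f 0 * g
0` and `-(f 0 * g 0)`. -/
theorem integral_greenIntegrand {f g : ℝ → ℝ} (hf : ContDiff ℝ 2 f) (hg : ContDiff ℝ 2 g)
    (hi : Integrable (greenIntegrand f g))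
    (hlim : Tendsto (boundaryForm f g) atTop (𝓝 0))
    (hlim' : Tendsto (boundaryForm (fun x => f (-x)) (fun x => g (-x))) atTop (𝓝 0)) :
    ∫ x, greenIntegrand f g x = 0 := by
  have h1 := integral_greenIntegrand_Ioi hf hg hi.integrableOn hlim
  have hn : greenIntegrand (fun x => f (-x)) (fun x => g (-x)) =
      fun x => -greenIntegrand f g (-x) := funext (greenIntegrand_comp_neg f g)
  have h2 := integral_greenIntegrand_Ioi (hf.comp contDiff_neg) (hg.comp contDiff_neg)
    (f := fun x => f (-x)) (g := fun x => g (-x)) (by rw [hn]; exact hi.comp_neg.neg.integrableOn)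
    hlim'
  rw [hn, integral_neg, integral_comp_neg_Ioi] at h2
  simp only [neg_zero] at h2
  rw [← integral_add_compl (measurableSet_Ioi (a := (0 : ℝ))) hi, compl_Ioi, h1]
  linarith

theorem tendsto_boundaryForm_of_integrable {f g : ℝ → ℝ} (hf : ContDiff ℝ 2 f)
    (hg : ContDiff ℝ 2 g) (hi : Integrable (greenIntegrand f g))
    (if0 : Integrable fun x => f x ^ 2 * besselK 0 |x|)
    (if1 : Integrable fun x => steinR f x ^ 2 * besselK 0 |x|)
    (ig0 : Integrable fun x => g x ^ 2 * besselK 0 |x|)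
    (ig1 : Integrable fun x => steinRAdj g x ^ 2 * besselK 0 |x|) :
    Tendsto (boundaryForm f g) atTop (𝓝 0) := by
  have key : ∀ {h : ℝ → ℝ}, Integrable (fun x => h x * besselK 0 |x|) →
      IntegrableOn (fun x => h x * besselK 0 x) (Ioi 1) := fun hh =>
    hh.integrableOn.congr_fun (fun x hx => by
      simp only [abs_of_pos (zero_lt_one.trans (mem_Ioi.1 hx))]) measurableSet_Ioi
  exact tendsto_boundaryForm_atTop hf hg hi.integrableOn (key if0) (key if1) (key ig0) (key ig1)

theorem integral_greenIntegrand_of_integrable {f g : ℝ → ℝ} (hf : ContDiff ℝ 2 f)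
    (hg : ContDiff ℝ 2 g) (hi : Integrable (greenIntegrand f g))
    (if0 : Integrable fun x => f x ^ 2 * besselK 0 |x|)
    (if1 : Integrable fun x => steinR f x ^ 2 * besselK 0 |x|)
    (ig0 : Integrable fun x => g x ^ 2 * besselK 0 |x|)
    (ig1 : Integrable fun x => steinRAdj g x ^ 2 * besselK 0 |x|) :
    ∫ x, greenIntegrand f g x = 0 := by
  refine integral_greenIntegrand hf hg hi
    (tendsto_boundaryForm_of_integrable hf hg hi if0 if1 ig0 ig1)
    (tendsto_boundaryForm_of_integrable (hf.comp contDiff_neg) (hg.comp contDiff_neg) ?_ ?_ ?_ ?_ ?_)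
  · rw [funext (greenIntegrand_comp_neg f g)]
    exact hi.comp_neg.neg
  · simpa only [abs_neg] using if0.comp_neg
  · simpa only [abs_neg, steinR_comp_neg, neg_sq] using if1.comp_neg
  · simpa only [abs_neg] using ig0.comp_neg
  · simpa only [abs_neg, steinRAdj_comp_neg, neg_sq] using ig1.comp_neg

/-! ### Test functions, the operator in L² and its adjoint -/

theorem eventuallyEq_zero_atTop_of_hasCompactSupport {f : ℝ → ℝ} (hf : HasCompactSupport f) :
    f =ᶠ[atTop] 0 := by
  rw [hasCompactSupport_iff_eventuallyEq, coclosedCompact_eq_cocompact] at hf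
  exact atTop_le_cocompact hf

theorem integrable_mul_of_hasCompactSupport {μ : Measure ℝ} {f h : ℝ → ℝ}
    (hh : LocallyIntegrable h μ) (hf : Continuous f) (hfc : HasCompactSupport f) :
    Integrable (fun x => f x * h x) μ := by
  have := hh.integrable_smul_left_of_hasCompactSupport hf hfc
  simpa only [smul_eq_mul] using this

theorem boundaryForm_eventuallyEq_zero {f : ℝ → ℝ} (hf : HasCompactSupport f) (g : ℝ → ℝ) :
    boundaryForm f g =ᶠ[atTop] fun _ => 0 := by
  have h0 : f =ᶠ[atTop] 0 := eventuallyEq_zero_atTop_of_hasCompactSupport hf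
  have h1 : deriv f =ᶠ[atTop] 0 := eventuallyEq_zero_atTop_of_hasCompactSupport hf.deriv
  filter_upwards [h0, h1] with x hx hx1
  simp [boundaryForm, hx, hx1]

theorem hasCompactSupport_steinR {f : ℝ → ℝ} (hf : HasCompactSupport f) :
    HasCompactSupport (steinR f) :=
  ((hf.mul_left (f := fun x => x)).sub hf.deriv).sub (hf.deriv.deriv.mul_left (f := fun x => x))

/-- The law of the product of two independent standard Gaussian variables, given by its density. -/
noncomputable def productLaw : Measure ℝ :=
  volume.withDensity fun x => ENNReal.ofReal (besselK 0 |x| / Real.pi)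

theorem measurable_density :
    Measurable fun x => ENNReal.ofReal (besselK 0 |x| / Real.pi) := by
  have := measurable_besselK 0
  have ha : Measurable fun x : ℝ => |x| := measurable_norm
  fun_prop

theorem besselK_zero_nonneg (x : ℝ) : 0 ≤ besselK 0 x := by
  rw [besselK]
  exact integral_nonneg fun t => by simp only [Pi.zero_apply]; positivity

theorem integrable_productLaw_iff {h : ℝ → ℝ} :
    Integrable h productLaw ↔ Integrable fun x => h x * besselK 0 |x| := by
  rw [productLaw, integrable_withDensity_iff_integrable_smul' measurable_density
    (Eventually.of_forall fun x => ENNReal.ofReal_lt_top)]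
  have : (fun x => (ENNReal.ofReal (besselK 0 |x| / Real.pi)).toReal • h x) =
      fun x => Real.pi⁻¹ * (h x * besselK 0 |x|) := funext fun x => by
    rw [ENNReal.toReal_ofReal (div_nonneg (besselK_zero_nonneg _) Real.pi_pos.le), smul_eq_mul]
    ring
  rw [this, integrable_const_mul_iff (isUnit_iff_ne_zero.2 (inv_ne_zero Real.pi_ne_zero))]

theorem integral_productLaw (h : ℝ → ℝ) :
    ∫ x, h x ∂productLaw = Real.pi⁻¹ * ∫ x, h x * besselK 0 |x| := by
  rw [productLaw, integral_withDensity_eq_integral_toReal_smul measurable_density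
    (Eventually.of_forall fun x => ENNReal.ofReal_lt_top), ← integral_const_mul]
  refine integral_congr_ae (Eventually.of_forall fun x => ?_)
  simp only
  rw [ENNReal.toReal_ofReal (div_nonneg (besselK_zero_nonneg _) Real.pi_pos.le), smul_eq_mul]
  ring

theorem volume_absolutelyContinuous_productLaw : volume ≪ productLaw := by
  refine withDensity_absolutelyContinuous' measurable_density.aemeasurable ?_
  filter_upwards [Measure.ae_ne volume 0] with x hx
  have := besselK_zero_pos (abs_pos.2 hx)
  simp only [ne_eq, ENNReal.ofReal_eq_zero, not_le]
  positivity

instance : productLaw.IsOpenPosMeasure :=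
  volume_absolutelyContinuous_productLaw.isOpenPosMeasure

theorem integral_steinR_mul_eq {f g : ℝ → ℝ}
    (h1 : Integrable (fun x => steinR f x * g x) productLaw)
    (h2 : Integrable (fun x => f x * steinRAdj g x) productLaw)
    (h : Integrable (greenIntegrand f g) → ∫ x, greenIntegrand f g x = 0) :
    ∫ x, steinR f x * g x ∂productLaw = ∫ x, f x * steinRAdj g x ∂productLaw := by
  rw [← sub_eq_zero, ← integral_sub h1 h2, integral_productLaw]
  have h3 := h (integrable_productLaw_iff.1 (h1.sub h2))
  unfold greenIntegrand at h3
  rw [h3, mul_zero]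

theorem integral_steinR_mul_of_memLp {f g : ℝ → ℝ} (hf : ContDiff ℝ 2 f) (hg : ContDiff ℝ 2 g)
    (hf0 : MemLp f 2 productLaw) (hf1 : MemLp (steinR f) 2 productLaw)
    (hg0 : MemLp g 2 productLaw) (hg1 : MemLp (steinRAdj g) 2 productLaw) :
    ∫ x, steinR f x * g x ∂productLaw = ∫ x, f x * steinRAdj g x ∂productLaw :=
  integral_steinR_mul_eq (hf1.integrable_mul hg0) (hf0.integrable_mul hg1) fun hi =>
    integral_greenIntegrand_of_integrable hf hg hi
      (integrable_productLaw_iff.1 hf0.integrable_sq)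
      (integrable_productLaw_iff.1 hf1.integrable_sq)
      (integrable_productLaw_iff.1 hg0.integrable_sq)
      (integrable_productLaw_iff.1 hg1.integrable_sq)

theorem inner_eq_integral_mul {μ : Measure ℝ} {u v : Lp ℝ 2 μ} {a b : ℝ → ℝ} (hu : u =ᵐ[μ] a)
    (hv : v =ᵐ[μ] b) : inner ℝ u v = ∫ x, a x * b x ∂μ := by
  rw [L2.inner_def]
  refine integral_congr_ae ?_
  filter_upwards [hu, hv] with x hx hy
  rw [hx, hy]
  exact mul_comm _ _

/-- The law charges every nonempty open set, so a continuous function is determined by its class;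
hence the class of `f` determines that of `R f`. -/
theorem steinOp_graph : (steinOp productLaw).graph = steinGraph productLaw := by
  refine Submodule.toLinearPMap_graph_eq _ ?_
  rintro ⟨a, b⟩ ⟨f, hf, ha, hb⟩ h0
  simp only at ha hb h0 ⊢
  have h1 : f =ᵐ[productLaw] fun _ => 0 := by
    rw [h0] at ha
    exact ha.symm.trans (Lp.coeFn_zero ℝ 2 productLaw)
  have h2 : f = fun _ => 0 := (hf.continuous.ae_eq_iff_eq _ continuous_const).1 h1
  refine Lp.ext (hb.trans (EventuallyEq.trans ?_ (Lp.coeFn_zero ℝ 2 productLaw).symm))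
  rw [h2]
  exact Eventually.of_forall fun x => by simp [steinR]

theorem exists_mem_domain_of_memLp {f : ℝ → ℝ} (hf : ContDiff ℝ 2 f) (h0 : MemLp f 2 productLaw)
    (h1 : MemLp (steinR f) 2 productLaw) :
    ∃ x : (steinOp productLaw).domain, (x : Lp ℝ 2 productLaw) =ᵐ[productLaw] f ∧
      steinOp productLaw x =ᵐ[productLaw] steinR f := by
  have h : (h0.toLp f, h1.toLp (steinR f)) ∈ (steinOp productLaw).graph := by
    rw [steinOp_graph]
    exact ⟨f, hf, h0.coeFn_toLp, h1.coeFn_toLp⟩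
  obtain ⟨x, hx, hy⟩ := (LinearPMap.mem_graph_iff _).1 h
  exact ⟨x, by rw [hx]; exact h0.coeFn_toLp, by rw [hy]; exact h1.coeFn_toLp⟩

theorem exists_contDiff_of_mem_domain (x : (steinOp productLaw).domain) :
    ∃ f : ℝ → ℝ, ContDiff ℝ 2 f ∧ (x : Lp ℝ 2 productLaw) =ᵐ[productLaw] f ∧
      steinOp productLaw x =ᵐ[productLaw] steinR f := by
  have h := (steinOp productLaw).mem_graph x
  rw [steinOp_graph] at h
  exact h

theorem mem_adjoint_domain_of_memLp {g : ℝ → ℝ} (hg : ContDiff ℝ 2 g) (hg0 : MemLp g 2 productLaw)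
    (hg1 : MemLp (steinRAdj g) 2 productLaw) :
    hg0.toLp g ∈ (steinOp productLaw).adjoint.domain := by
  refine LinearPMap.mem_adjoint_domain_of_exists _ ⟨hg1.toLp _, fun x => ?_⟩
  obtain ⟨f, hf, hx, hTx⟩ := exists_contDiff_of_mem_domain x
  rw [inner_eq_integral_mul hg1.coeFn_toLp hx, inner_eq_integral_mul hg0.coeFn_toLp hTx]
  have h := integral_steinR_mul_of_memLp hf hg ((memLp_congr_ae hx).1 (Lp.memLp _))
    ((memLp_congr_ae hTx).1 (Lp.memLp _)) hg0 hg1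
  simp only [mul_comm (steinRAdj g _), mul_comm (g _)]
  exact h.symm

section Operator

variable [IsProbabilityMeasure productLaw]

/-- Apart from `theta`, everything in the expression is continuous, and `theta` is integrable as a
conditional mean, so no asymptotics at `0` are needed. -/
theorem locallyIntegrable_steinRAdj (hθ : Integrable theta productLaw) {g : ℝ → ℝ}
    (hg : ContDiff ℝ 2 g) : LocallyIntegrable (steinRAdj g) productLaw := by
  obtain ⟨-, -, c0, c1, -⟩ := hasDerivAt_of_contDiff_two hg
  have hc : Continuous fun x => steinR g x - x * g x := by
    have := continuous_steinR hg
    fun_prop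
  have h : LocallyIntegrable (fun x => deriv g x * theta x) productLaw := by
    rw [← locallyIntegrableOn_univ]
    exact (hθ.locallyIntegrable.locallyIntegrableOn univ).continuousOn_mul c1.continuousOn
      isOpen_univ.isLocallyClosed
  have e : steinRAdj g = (fun x => steinR g x - x * g x) + fun x => deriv g x * theta x :=
    funext fun x => by
      simp only [steinRAdj, Pi.add_apply]
      ring
  rw [e]
  exact hc.locallyIntegrable.add h

theorem integral_steinR_mul_of_hasCompactSupport (hθ : Integrable theta productLaw) {f g : ℝ → ℝ}
    (hf : ContDiff ℝ 2 f) (hfc : HasCompactSupport f) (hg : ContDiff ℝ 2 g) :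
    Integrable (fun x => f x * steinRAdj g x) productLaw ∧
    ∫ x, steinR f x * g x ∂productLaw = ∫ x, f x * steinRAdj g x ∂productLaw := by
  have h2 : Integrable (fun x => f x * steinRAdj g x) productLaw :=
    integrable_mul_of_hasCompactSupport (locallyIntegrable_steinRAdj hθ hg) hf.continuous hfc
  have h1 : Integrable (fun x => steinR f x * g x) productLaw :=
    ((continuous_steinR hf).mul hg.continuous).integrable_of_hasCompactSupport
      (hasCompactSupport_steinR hfc).mul_right
  refine ⟨h2, integral_steinR_mul_eq h1 h2 fun hi => integral_greenIntegrand hf hg hi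
    (tendsto_const_nhds.congr' (boundaryForm_eventuallyEq_zero hfc g).symm)
    (tendsto_const_nhds.congr' (boundaryForm_eventuallyEq_zero ?_ _).symm)⟩
  exact hfc.comp_homeomorph (Homeomorph.neg ℝ)

theorem exists_mem_domain_of_hasCompactSupport {f : ℝ → ℝ} (hf : ContDiff ℝ 2 f)
    (hfc : HasCompactSupport f) :
    ∃ x : (steinOp productLaw).domain, (x : Lp ℝ 2 productLaw) =ᵐ[productLaw] f ∧
      steinOp productLaw x =ᵐ[productLaw] steinR f :=
  exists_mem_domain_of_memLp hf (hf.continuous.memLp_of_hasCompactSupport hfc)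
    ((continuous_steinR hf).memLp_of_hasCompactSupport (hasCompactSupport_steinR hfc))

/-- The domain contains all smooth compactly supported functions, and an `L²` function orthogonal to
these vanishes almost everywhere. -/
theorem dense_steinOp_domain : Dense ((steinOp productLaw).domain : Set (Lp ℝ 2 productLaw)) := by
  rw [Submodule.dense_iff_topologicalClosure_eq_top, Submodule.topologicalClosure_eq_top_iff,
    Submodule.eq_bot_iff]
  intro h hh
  have hi : LocallyIntegrable h productLaw :=
    ((Lp.memLp h).integrable one_le_two).locallyIntegrable
  refine Lp.ext (EventuallyEq.trans ?_ (Lp.coeFn_zero ℝ 2 productLaw).symm)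
  refine ae_eq_zero_of_integral_contDiff_smul_eq_zero hi fun f hf hfc => ?_
  obtain ⟨x, hx, -⟩ := exists_mem_domain_of_hasCompactSupport
    (hf.of_le (by norm_cast)) hfc
  have h1 := (Submodule.mem_orthogonal _ _).1 hh x x.2
  rwa [inner_eq_integral_mul hx (EventuallyEq.refl _ _)] at h1

/-- The abstract adjoint and `steinRAdj g` have the same integral against every test function, and
both are locally integrable. Membership of `steinRAdj g` in `L²` is thus a conclusion, not an
assumption. -/
theorem adjoint_ae_eq_steinRAdj (hθ : Integrable theta productLaw) {g : ℝ → ℝ}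
    (hg : ContDiff ℝ 2 g) (hg0 : MemLp g 2 productLaw)
    (h : hg0.toLp g ∈ (steinOp productLaw).adjoint.domain) :
    (steinOp productLaw).adjoint ⟨hg0.toLp g, h⟩ =ᵐ[productLaw] steinRAdj g := by
  set w := (steinOp productLaw).adjoint ⟨hg0.toLp g, h⟩ with hw
  have hwi : LocallyIntegrable w productLaw :=
    ((Lp.memLp w).integrable one_le_two).locallyIntegrable
  have hz := ae_eq_zero_of_integral_contDiff_smul_eq_zero
    (hwi.sub (locallyIntegrable_steinRAdj hθ hg)) fun f hf hfc => ?_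
  · filter_upwards [hz] with x hx
    exact sub_eq_zero.1 hx
  · have hf2 : ContDiff ℝ 2 f := hf.of_le (by norm_cast)
    obtain ⟨x, hx, hTx⟩ := exists_mem_domain_of_hasCompactSupport hf2 hfc
    have h1 := LinearPMap.adjoint_isFormalAdjoint dense_steinOp_domain ⟨hg0.toLp g, h⟩ x
    rw [← hw, inner_eq_integral_mul (EventuallyEq.refl _ _) hx,
      inner_eq_integral_mul hg0.coeFn_toLp hTx] at h1
    obtain ⟨h2, h3⟩ := integral_steinR_mul_of_hasCompactSupport hθ hf2 hfc hg
    have h4 : Integrable (fun x => f x * w x) productLaw :=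
      integrable_mul_of_hasCompactSupport hwi hf2.continuous hfc
    simp only [Pi.sub_apply, smul_eq_mul, mul_sub]
    rw [integral_sub h4 h2, ← h3]
    simp only [mul_comm (f _), mul_comm (steinR f _)]
    rw [h1, sub_self]

end Operator

end NormalProduct

theorem proposition2p2 {Ω : Type*} [MeasurableSpace Ω] (P : Measure Ω) [IsProbabilityMeasure P]
    (N₁ N₂ : Ω → ℝ) (hN₁ : Measurable N₁) (hN₂ : Measurable N₂)
    (hlaw₁ : P.map N₁ = gaussianReal 0 1) (hlaw₂ : P.map N₂ = gaussianReal 0 1)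
    (hindep : IndepFun N₁ N₂ P)
    (μ : Measure ℝ) (hμ : μ = P.map (fun ω => N₁ ω * N₂ ω)) :
    -- `R` is a well-defined, densely defined operator in `L²(μ)`
    (NormalProduct.steinOp μ).graph = NormalProduct.steinGraph μ ∧
    Dense ((NormalProduct.steinOp μ).domain : Set (Lp ℝ 2 μ)) ∧
    -- its Hilbert space adjoint is given by the differential expression `R g + θ g' - x g`
    (∀ (g : ℝ → ℝ) (_ : ContDiff ℝ 2 g) (hg : MemLp g 2 μ),
      (hg.toLp g ∈ (NormalProduct.steinOp μ).adjoint.domain ↔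
        MemLp (NormalProduct.steinRAdj g) 2 μ) ∧
      ∀ h : hg.toLp g ∈ (NormalProduct.steinOp μ).adjoint.domain,
        (NormalProduct.steinOp μ).adjoint ⟨hg.toLp g, h⟩ =ᵐ[μ] NormalProduct.steinRAdj g) ∧
    -- `θ` is the conditional expectation of `N₁² + N₂²` given the product
    P[fun ω => N₁ ω ^ 2 + N₂ ω ^ 2 |
        MeasurableSpace.comap (fun ω => N₁ ω * N₂ ω) inferInstance]
      =ᵐ[P] fun ω => NormalProduct.theta (N₁ ω * N₂ ω) := by
  have hT : Measurable fun ω => N₁ ω * N₂ ω := hN₁.mul hN₂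
  have hlaw : P.map (fun ω => N₁ ω * N₂ ω) = NormalProduct.productLaw :=
    NormalProduct.map_mul_eq_withDensity hN₁ hN₂ hlaw₁ hlaw₂ hindep
  have hprob : IsProbabilityMeasure NormalProduct.productLaw :=
    hlaw ▸ Measure.isProbabilityMeasure_map hT.aemeasurable
  have hθ : Integrable NormalProduct.theta NormalProduct.productLaw := by
    rw [← hlaw, integrable_map_measure NormalProduct.measurable_theta.aestronglyMeasurable
      hT.aemeasurable]
    exact NormalProduct.integrable_theta_mul hN₁ hN₂ hlaw₁ hlaw₂ hindep
  rw [hlaw] at hμ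
  subst hμ
  refine ⟨NormalProduct.steinOp_graph, NormalProduct.dense_steinOp_domain, fun g hg hg0 =>
    ⟨⟨fun h => ?_, NormalProduct.mem_adjoint_domain_of_memLp hg hg0⟩,
      NormalProduct.adjoint_ae_eq_steinRAdj hθ hg hg0⟩,
    NormalProduct.condExp_sq_add_sq hN₁ hN₂ hlaw₁ hlaw₂ hindep⟩
  exact (memLp_congr_ae (NormalProduct.adjoint_ae_eq_steinRAdj hθ hg hg0 h)).1 (Lp.memLp _)
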